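/- Let $f,g$ be probability densities on $\mathbb{R}^d$ with respect to Lebesgue measure, and let $X_1,X_2,\dots$ IID with density $f$ and $Y_1,Y_2,\dots$ IID with density $g$ be two independent sequences. Let $p\in(0,1)$, and let $m,n$ vary along a sequence with $t=m+n\to\infty$ and $m/(m+n)\to p$. Let $\mathbf{Z}=\{Z_1,\dots,Z_t\}$ be the combined sample, $Z_k=X_k$ for $k\le m$ and $Z_k=Y_{k-m}$ for $m<k\le t$. Let $\lambda:[0,\infty)\to\mathbb{R}$ be non-decreasing with $\lambda(b)\asymp b^\alpha$ as $b\to0^+$ for some $\alpha\in(0,d)$. A matching of a finite set $\{z_1,\dots,z_t\}\subset\mathbb{R}^d$ is a permutation $\sigma$ of $\{1,\dots,t\}$ with $\sigma(\sigma(k))=k$ for all $k$ and at most one fixed point; it is optimal if it minimizes $\sum_{k=1}^t\lambda(\|z_k-z_{\sigma(k)}\|)$ (Euclidean norm) among all matchings. Let $\mathcal{G}$ be a graph construction that attaches to every finite unordered set of points the graph with edges $z_k\to z_{\sigma(k)}$ ($\sigma(k)\neq k$) of one of its optimal matchings $\sigma$. When there are several optimal matchings, the choice among them is a measurable function of the unordered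 point set and, possibly, of a random seed that is independent of the samples. Put $$\chi_{\mathcal{G}}(\mathbf{Z})=\#\{(i,j): i\le m<j,\ Z_i\to Z_j \text{ in } \mathcal{G}(\mathbf{Z})\}+\#\{(i,j): i\le m<j,\ Z_j\to Z_i\text{ in } \mathcal{G}(\mathbf{Z})\}.$$ Then, almost surely, $$\frac{\chi_{\mathcal{G}}(\mathbf{Z})}{m+n}\longrightarrow\int_{\mathbb{R}^d}\frac{2p(1-p)f(z)g(z)}{pf(z)+(1-p)g(z)}\,\mathrm{d}z,$$ where the integrand is read as $0$ where $f=g=0$. In particular, this holds for $d\ge2$ and the Euclidean crossmatch matching $\lambda(b)=b$, which minimizes $\sum_k\|z_k-z_{\sigma(k)}\|$. -/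

import Mathlib

open MeasureTheory ProbabilityTheory Filter Topology Asymptotics

noncomputable section

/-- A matching of a finite set `A`: a permutation `σ` of `A` with `σ (σ z) = z` for all `z` and with
at most one fixed point. -/
def IsMatching {E : Type*} {A : Finset E} (σ : Equiv.Perm A) : Prop :=
  (∀ z, σ (σ z) = z) ∧ ∀ z w, σ z = z → σ w = w → z = w

/-- The cost `Λ(A; σ) = ∑_{z ∈ A} λ(‖z - σ(z)‖)`. -/
def matchingCost {E : Type*} [NormedAddCommGroup E] (lam : ℝ → ℝ) {A : Finset E}
    (σ : Equiv.Perm A) : ℝ :=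
  ∑ z : A, lam ‖(z : E) - (σ z : E)‖

/-- `σ` minimizes the cost among all matchings of `A`. -/
def IsOptimalMatching {E : Type*} [NormedAddCommGroup E] (lam : ℝ → ℝ) {A : Finset E}
    (σ : Equiv.Perm A) : Prop :=
  IsMatching σ ∧ ∀ τ : Equiv.Perm A, IsMatching τ → matchingCost lam σ ≤ matchingCost lam τ

/-- The graph of a matching `σ` of `A`: edges `z → σ(z)` for the `z ∈ A` that are not fixed. For a
matching this relation is symmetric, and no point outside `A` is on an edge. -/
def matchingGraph {E : Type*} {A : Finset E} (σ : Equiv.Perm A) : Digraph E where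
  Adj x y := ∃ z : A, σ z ≠ z ∧ x = z ∧ y = σ z

open Classical in
/-- `G` is an optimal matching graph construction for the cost function `lam`: to each finite
(unordered) set of points it attaches the graph of an optimal matching. Where there are several
optimal matchings, the choice may depend on a parameter `u` (the seed of a random choice); it is
jointly measurable in the seed and in the points. -/
structure IsOptimalMatchingConstruction {E : Type*} [NormedAddCommGroup E] [MeasurableSpace E]
    {S : Type*} [MeasurableSpace S] (lam : ℝ → ℝ) (G : S → Finset E → Digraph E) :
    Prop where
  optimal : ∀ (u : S) (A : Finset E), ∃ σ : Equiv.Perm A, IsOptimalMatching lam σ ∧ G u A = matchingGraph σ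
  measurable : ∀ (t : ℕ) (i j : Fin t),
    MeasurableSet {q : S × (Fin t → E) | (G q.1 (Finset.univ.image q.2)).Adj (q.2 i) (q.2 j)}

open Classical in
/-- The combined sample, made of the first `m` of the `x`'s and the first `n` of the `y`'s. -/
def combinedSample {E : Type*} (m n : ℕ) (x y : ℕ → E) : Finset E :=
  (Finset.range m).image x ∪ (Finset.range n).image y

open Classical in
/-- The number of edges from one of the first `m` of the `x`'s to one of the first `n` of the `y`'s,
plus the number of edges in the other direction. -/
def crossCount {E : Type*} (H : Digraph E) (m n : ℕ) (x y : ℕ → E) : ℕ :=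
  ((Finset.range m ×ˢ Finset.range n).filter fun ij => H.Adj (x ij.1) (y ij.2)).card +
    ((Finset.range m ×ˢ Finset.range n).filter fun ij => H.Adj (y ij.2) (x ij.1)).card

end

open scoped NNReal ENNReal

/-! Replace the fixed sample sizes by random labels: draw $t$ points from the mixture density
$\varphi = pf+(1-p)g$ and label a point at $z$ as an $X$ with probability $r(z)=pf(z)/\varphi(z)$,
independently. An optimal matching sees only the points, so given the points the labels are still
independent and a matched pair $z,w$ contributes $2\bigl(r(z)(1-r(w))+r(w)(1-r(z))\bigr)$ to the
expected count. If partners are close, this sums to about $\sum_k 2r(z_k)(1-r(z_k))$, and the law of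
large numbers gives $\int 2r(1-r)\varphi$, the stated limit.

Partners are close because of a swap: two long edges with nearby endpoints could be exchanged for
two short, cheaper ones. Hence a ball contains boundedly many long edges, uniformly in the sample
(`exists_card_long_edges_le`). Approximating $r$ in $L^1$ by a continuous function of compact
support turns this into the estimate `abs_sum_mul_sub_le`, without regularity of the densities.

Hoeffding's inequality for the points and for the labels makes the deviation probability
exponentially small (`exists_lintegral_label_deviation_le`). Conditioning on exactly $m$ labels of
type $X$ divides it by a binomial probability, which for $m/t$ near $p$ is at least a slower
exponential over $t+1$ (`choose_mul_measure_le_lintegral`, `pow_le_succ_mul_choose_mul`). An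
exponential bound survives, and Borel–Cantelli concludes. -/

/-! ### Swaps and long edges in optimal matchings. -/

theorem IsMatching.conj {E : Type*} {A : Finset E} {σ : Equiv.Perm A} (h : IsMatching σ)
    (π : Equiv.Perm A) : IsMatching (π * σ * π⁻¹) := by
  refine ⟨fun z => by simp [h.1], fun z w hz hw => ?_⟩
  have hz' : σ (π⁻¹ z) = π⁻¹ z := by
    rw [Equiv.Perm.eq_inv_iff_eq]; simpa using hz
  have hw' : σ (π⁻¹ w) = π⁻¹ w := by
    rw [Equiv.Perm.eq_inv_iff_eq]; simpa using hw
  exact π⁻¹.injective (h.2 _ _ hz' hw')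

/-- Exchanging the partners of two edges does not decrease the cost of an optimal matching. -/
theorem IsOptimalMatching.add_le_swap {E : Type*} [NormedAddCommGroup E] {lam : ℝ → ℝ}
    {A : Finset E} {σ : Equiv.Perm A} (h : IsOptimalMatching lam σ) {z w : A} (hzw : w ≠ z)
    (hw : w ≠ σ z) (hzz : σ z ≠ z) (hww : σ w ≠ w) :
    lam ‖(z : E) - σ z‖ + lam ‖(w : E) - σ w‖ ≤ lam ‖(z : E) - w‖ + lam ‖(σ z : E) - σ w‖ := by
  classical
  have inv := h.1.1
  have h1 : σ w ≠ z := fun e => hw (by rw [← e, inv])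
  have h2 : σ w ≠ σ z := fun e => hzw (σ.injective e)
  -- Conjugation by this transposition re-pairs $z$ with $w$ and $\sigma(z)$ with $\sigma(w)$, and
  -- keeps all other pairs.
  set π := Equiv.swap w (σ z) with hπ
  set τ := π * σ * π⁻¹ with hτ
  have hτ' : ∀ a, τ a = π (σ (π a)) := fun a => by simp [hτ, hπ]
  have πz : π z = z := Equiv.swap_apply_of_ne_of_ne hzw.symm hzz.symm
  have πσw : π (σ w) = σ w := Equiv.swap_apply_of_ne_of_ne hww h2
  have πw : π w = σ z := Equiv.swap_apply_left _ _
  have πσz : π (σ z) = w := Equiv.swap_apply_right _ _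
  have e1 : τ z = w := by rw [hτ', πz, πσz]
  have e2 : τ w = z := by rw [hτ', πw, inv, πz]
  have e3 : τ (σ z) = σ w := by rw [hτ', πσz, πσw]
  have e4 : τ (σ w) = σ z := by rw [hτ', πσw, inv, πw]
  have key := h.2 τ (h.1.conj π)
  unfold matchingCost at key
  let s : Finset A := {z, w, σ z, σ w}
  rw [← Finset.sum_add_sum_compl s, ← Finset.sum_add_sum_compl s (fun a : A => lam ‖(a : E) - τ a‖)]
    at key
  have hcompl : ∑ a ∈ sᶜ, lam ‖(a : E) - σ a‖ = ∑ a ∈ sᶜ, lam ‖(a : E) - τ a‖ := by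
    refine Finset.sum_congr rfl fun a ha => ?_
    simp only [s, Finset.mem_compl, Finset.mem_insert, Finset.mem_singleton, not_or] at ha
    obtain ⟨haz, haw, ha3, ha4⟩ := ha
    have i1 : π a = a := Equiv.swap_apply_of_ne_of_ne haw ha3
    have i2 : π (σ a) = σ a := by
      refine Equiv.swap_apply_of_ne_of_ne (fun e => ha4 ?_) (fun e => haz (σ.injective e))
      rw [← e, inv]
    rw [hτ', i1, i2]
  rw [hcompl, add_le_add_iff_right] at key
  -- The cost counts every edge from both ends, so the comparison on these four points is twice the
  -- claim.
  have sum_s : ∀ F : A → ℝ, ∑ a ∈ s, F a = F z + (F w + (F (σ z) + F (σ w))) := fun F => by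
    rw [Finset.sum_insert, Finset.sum_insert, Finset.sum_insert, Finset.sum_singleton]
    · simpa using h2.symm
    · simp [hw, hww.symm]
    · simp [hzw.symm, hzz.symm, h1.symm]
  rw [sum_s, sum_s, e1, e2, e3, e4, inv, inv, norm_sub_rev (σ z : E) z, norm_sub_rev (σ w : E) w,
    norm_sub_rev (w : E) z, norm_sub_rev (σ w : E) (σ z)] at key
  linarith

open Classical in
/-- The number of long edges inside a ball is bounded, uniformly over all optimal matchings. -/
theorem exists_card_long_edges_le {E : Type*} [NormedAddCommGroup E] [ProperSpace E] {lam : ℝ → ℝ}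
    (hmono : MonotoneOn lam (Set.Ici 0)) (hpos : ∀ b, 0 < b → 0 < lam b)
    (hlim : Tendsto lam (𝓝[>] 0) (𝓝 0)) (R : ℝ) {δ : ℝ} (hδ : 0 < δ) :
    ∃ C : ℕ, ∀ (A : Finset E) (σ : Equiv.Perm A), IsOptimalMatching lam σ →
      (Finset.univ.filter fun z : A =>
        ‖(z : E)‖ ≤ R ∧ ‖(σ z : E)‖ ≤ R ∧ δ ≤ ‖(z : E) - σ z‖).card ≤ C := by
  -- Edges of length at most `η` are strictly cheaper than edges of length at least `δ`.
  obtain ⟨η, hη0, hη⟩ : ∃ η, 0 < η ∧ lam η < lam δ := by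
    have h := (hlim.eventually (gt_mem_nhds (hpos δ hδ))).and self_mem_nhdsWithin
    obtain ⟨η, h1, h2⟩ := h.exists
    exact ⟨η, h2, h1⟩
  have short : ∀ x y : E, ‖x - y‖ ≤ η → lam ‖x - y‖ ≤ lam η := fun x y h =>
    hmono (norm_nonneg _) hη0.le h
  have long : ∀ x y : E, δ ≤ ‖x - y‖ → lam δ ≤ lam ‖x - y‖ := fun x y h =>
    hmono hδ.le (norm_nonneg _) h
  obtain ⟨T, hT, hcov⟩ := Metric.totallyBounded_iff.1
    (isCompact_closedBall (0 : E) R).totallyBounded (η / 2) (half_pos hη0)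
  have hc : ∀ x : E, ∃ c, ‖x‖ ≤ R → c ∈ T ∧ dist x c < η / 2 := fun x => by
    by_cases hx : ‖x‖ ≤ R
    · have := hcov (mem_closedBall_zero_iff.2 hx)
      simp only [Set.mem_iUnion, Metric.mem_ball] at this
      obtain ⟨c, hc, hd⟩ := this
      exact ⟨c, fun _ => ⟨hc, hd⟩⟩
    · exact ⟨0, fun h => absurd h hx⟩
  choose c hc using hc
  have close : ∀ x y : E, ‖x‖ ≤ R → ‖y‖ ≤ R → c x = c y → ‖x - y‖ ≤ η := fun x y hx hy e => by
    have h1 := (hc x hx).2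
    have h2 := (hc y hy).2
    rw [← e] at h2
    rw [← dist_eq_norm]
    linarith [dist_triangle_right x y (c x)]
  -- Pigeonhole on pairs of cells: two long edges with the same cells at their ends could be swapped
  -- for two edges of length at most `η`.
  refine ⟨(hT.toFinset ×ˢ hT.toFinset).card, fun A σ h => ?_⟩
  refine Finset.card_le_card_of_injOn (fun z => (c z, c (σ z))) ?_ ?_
  · intro z hz
    simp only [Finset.coe_filter, Finset.mem_univ, true_and, Set.mem_ofPred_eq] at hz
    simp only [Finset.coe_product, Set.mem_prod, Finset.mem_coe, Set.Finite.mem_toFinset]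
    exact ⟨(hc _ hz.1).1, (hc _ hz.2.1).1⟩
  · intro z hz w hw e
    simp only [Finset.coe_filter, Finset.mem_univ, true_and, Set.mem_ofPred_eq] at hz hw
    simp only [Prod.mk.injEq] at e
    obtain ⟨hz1, hz2, hz3⟩ := hz
    obtain ⟨hw1, hw2, hw3⟩ := hw
    have c1 := short _ _ (close _ _ hz1 hw1 e.1)
    have c2 := short _ _ (close _ _ hz2 hw2 e.2)
    have l1 := long _ _ hz3
    have l2 := long _ _ hw3
    have nofix : ∀ a : A, δ ≤ ‖(a : E) - σ a‖ → σ a ≠ a := fun a ha hfix => by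
      rw [hfix, sub_self, norm_zero] at ha; linarith
    by_contra hne
    -- If $w=\sigma(z)$, both ends of one edge lie in one cell, so that edge is not long.
    have hwz : w ≠ σ z := fun hh => by rw [hh] at c1; linarith
    have := h.add_le_swap (Ne.symm hne) hwz (nofix z hz3) (nofix w hw3)
    linarith

/-! ### Matchings on indices and counts of label crossings. -/

open Classical in
/-- An optimal matching of the range of an injective family, as an involution of the index set. -/
theorem exists_index_involution {E : Type*} [NormedAddCommGroup E] {ι : Type*} [Fintype ι]
    {lam : ℝ → ℝ} {z : ι → E} (hz : Function.Injective z)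
    {σ : Equiv.Perm (Finset.univ.image z : Finset E)} (h : IsOptimalMatching lam σ)
    {R δ : ℝ} {C : ℕ}
    (hC : (Finset.univ.filter fun a : (Finset.univ.image z : Finset E) =>
        ‖(a : E)‖ ≤ R ∧ ‖(σ a : E)‖ ≤ R ∧ δ ≤ ‖(a : E) - σ a‖).card ≤ C) :
    ∃ s : ι → ι, Function.Involutive s ∧ (∀ k l, s k = k → s l = l → k = l) ∧
      (∀ k l, (matchingGraph σ).Adj (z k) (z l) ↔ s k ≠ k ∧ l = s k) ∧
      (Finset.univ.filter fun k => ‖z k‖ ≤ R ∧ ‖z (s k)‖ ≤ R ∧ δ ≤ ‖z k - z (s k)‖).card ≤ C := by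
  let e : ι → (Finset.univ.image z : Finset E) := fun k => ⟨z k, by simp⟩
  have he : Function.Bijective e := by
    refine ⟨fun a b hab => hz (congrArg Subtype.val hab), fun a => ?_⟩
    obtain ⟨k, -, hk⟩ := Finset.mem_image.1 a.2
    exact ⟨k, Subtype.ext hk⟩
  let f := Equiv.ofBijective e he
  have hf : ∀ k, (f k : E) = z k := fun k => rfl
  let s : ι → ι := fun k => f.symm (σ (f k))
  have hs : ∀ k, f (s k) = σ (f k) := fun k => by simp [s]
  have hs' : ∀ k, s k = k ↔ σ (f k) = f k := fun k => by rw [← hs, f.apply_eq_iff_eq]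
  refine ⟨s, fun k => by simp [s, h.1.1], fun k l hk hl => ?_, fun k l => ?_, ?_⟩
  · exact f.injective (h.1.2 _ _ ((hs' k).1 hk) ((hs' l).1 hl))
  · constructor
    · rintro ⟨a, ha, h1, h2⟩
      have : f k = a := Subtype.ext h1
      subst this
      refine ⟨fun hk => ha ((hs' k).1 hk), f.injective (Subtype.ext ?_)⟩
      rw [hs]; exact h2
    · rintro ⟨hk, rfl⟩
      refine ⟨f k, fun hh => hk ((hs' k).2 hh), rfl, ?_⟩
      rw [← hf, hs]
  · refine le_trans (Finset.card_le_card_of_injOn f ?_ f.injective.injOn) hC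
    intro k hk
    simp only [Finset.coe_filter, Finset.mem_univ, true_and, Set.mem_ofPred_eq] at hk ⊢
    rw [← hs]
    exact hk

open Classical in
/-- The number of edges between points of different labels. -/
noncomputable def labelCrossings {E ι : Type*} [Fintype ι] (H : Digraph E) (ℓ : ι → Bool) (z : ι → E) : ℝ :=
  ∑ k, ∑ l, if ℓ k = true ∧ ℓ l = false then
    (if H.Adj (z k) (z l) then (1 : ℝ) else 0) + (if H.Adj (z l) (z k) then (1 : ℝ) else 0) else 0

-- Combined with the fact that the graph depends only on the set of points, this makes the deviation
-- event invariant under renumbering.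
open Classical in
theorem labelCrossings_comp_equiv {E ι κ : Type*} [Fintype ι] [Fintype κ] (H : Digraph E)
    (ℓ : ι → Bool) (z : ι → E) (e : κ ≃ ι) :
    labelCrossings H (ℓ ∘ e) (z ∘ e) = labelCrossings H ℓ z := by
  exact Fintype.sum_equiv e _ _ fun k => Fintype.sum_equiv e _ _ fun l => rfl

-- A matching graph is symmetric, so both adjacency terms agree, whence the factor 2. Fixed points
-- drop out, since one point cannot carry both labels.
open Classical in
theorem labelCrossings_eq_of_involutive {E ι : Type*} [Fintype ι] {H : Digraph E} {z : ι → E}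
    {s : ι → ι} (hs : Function.Involutive s)
    (hadj : ∀ k l, H.Adj (z k) (z l) ↔ s k ≠ k ∧ l = s k) (ℓ : ι → Bool) :
    labelCrossings H ℓ z = 2 * ∑ k, if ℓ k = true ∧ ℓ (s k) = false then (1 : ℝ) else 0 := by
  unfold labelCrossings
  rw [Finset.mul_sum]
  refine Finset.sum_congr rfl fun k _ => ?_
  rw [Finset.sum_eq_single (s k)]
  · have h0 : ℓ k = true ∧ ℓ (s k) = false → s k ≠ k := by
      rintro ⟨h1, h2⟩ h3
      rw [h3, h1] at h2; exact absurd h2 (by simp)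
    by_cases h : ℓ k = true ∧ ℓ (s k) = false
    · have := h0 h
      simp [h, hadj, hs k, this, this.symm]; norm_num
    · simp [h]
  · intro l _ hl
    have h1 : ¬ H.Adj (z k) (z l) := fun h => hl ((hadj k l).1 h).2
    have h2 : ¬ H.Adj (z l) (z k) := fun h => hl (by rw [((hadj l k).1 h).2, hs])
    simp [h1, h2]
  · simp

theorem image_append_eq_combinedSample {E : Type*} (m n : ℕ) (x y : ℕ → E) [DecidableEq E] :
    Finset.univ.image (Fin.append (fun i : Fin m => x i) (fun j : Fin n => y j)) =
      combinedSample m n x y := by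
  ext a
  simp only [combinedSample, Finset.mem_image, Finset.mem_univ, true_and, Finset.mem_union,
    Finset.mem_range]
  constructor
  · rintro ⟨k, rfl⟩
    refine Fin.addCases (fun i => ?_) (fun j => ?_) k
    · exact Or.inl ⟨i, i.2, by simp⟩
    · exact Or.inr ⟨j, j.2, by simp⟩
  · rintro (⟨i, hi, rfl⟩ | ⟨j, hj, rfl⟩)
    · exact ⟨Fin.castAdd n ⟨i, hi⟩, Fin.append_left _ _ _⟩
    · exact ⟨Fin.natAdd m ⟨j, hj⟩, Fin.append_right _ _ _⟩

/-- Both sides count pairs of indices, not of points, so coinciding sample points do no harm. -/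
theorem crossCount_eq_labelCrossings {E : Type*} (H : Digraph E) (m n : ℕ) (x y : ℕ → E) :
    (crossCount H m n x y : ℝ) =
      labelCrossings H (Fin.append (fun _ : Fin m => true) (fun _ : Fin n => false))
        (Fin.append (fun i : Fin m => x i) (fun j : Fin n => y j)) := by
  unfold crossCount labelCrossings
  simp only [Fin.sum_univ_add, Fin.append_left, Fin.append_right, Nat.cast_add,
    Finset.card_filter, Finset.sum_product, Finset.sum_range, Nat.cast_sum, Nat.cast_ite,
    Nat.cast_one, Nat.cast_zero]
  have h1 : ∀ i : Fin m, Fin.append (fun i : Fin m => x i) (fun j : Fin n => y j)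
      (Fin.castAdd n i) = x i := fun i => Fin.append_left _ _ _
  have h2 : ∀ j : Fin n, Fin.append (fun i : Fin m => x i) (fun j : Fin n => y j)
      (Fin.natAdd m j) = y j := fun j => Fin.append_right _ _ _
  simp only [h1, h2, and_false, and_true, if_false, if_true, reduceCtorEq, Finset.sum_const_zero,
    add_zero, zero_add, Finset.sum_add_distrib]
  congr 1
  · refine Finset.sum_congr rfl fun i _ => Finset.sum_congr rfl fun j _ => ?_
    rw [h1, h2]
  · refine Finset.sum_congr rfl fun i _ => Finset.sum_congr rfl fun j _ => ?_
    rw [h1, h2]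

/-! ### Sub-Gaussian concentration. -/

theorem ProbabilityTheory.HasSubgaussianMGF.mono {Ω : Type*} [MeasurableSpace Ω] {μ : Measure Ω}
    {X : Ω → ℝ} {c c' : ℝ≥0} (h : HasSubgaussianMGF X c μ) (hc : c ≤ c') :
    HasSubgaussianMGF X c' μ where
  integrable_exp_mul := h.integrable_exp_mul
  mgf_le t := (h.mgf_le t).trans (Real.exp_le_exp.2 (by gcongr))

/-- Two-sided tail bound for a sub-Gaussian variable with variance proxy `t * c`. -/
theorem ProbabilityTheory.HasSubgaussianMGF.measureReal_abs_ge_le {Ω : Type*} [MeasurableSpace Ω]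
    {μ : Measure Ω} [IsProbabilityMeasure μ] {X : Ω → ℝ} {t : ℕ} {c : ℝ≥0}
    (h : HasSubgaussianMGF X (t * c) μ) {ε : ℝ} (hε : 0 ≤ ε) :
    μ.real {ω | ε * t ≤ |X ω|} ≤ 2 * Real.exp (-(ε ^ 2 / (2 * c)) * t) := by
  have hsub : {ω | ε * t ≤ |X ω|} ⊆ {ω | ε * t ≤ X ω} ∪ {ω | ε * t ≤ (-X) ω} := by
    intro ω hω
    rcases le_abs.1 (show ε * t ≤ |X ω| from hω) with h | h
    · exact Or.inl h
    · exact Or.inr h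
  have he : -(ε * t) ^ 2 / (2 * ((t * c : ℝ≥0) : ℝ)) = -(ε ^ 2 / (2 * c)) * t := by
    push_cast
    rcases eq_or_ne (t : ℝ) 0 with ht | ht
    · simp [ht]
    rcases eq_or_ne (c : ℝ) 0 with hc | hc
    · simp [hc]
    field_simp
  have h1 := h.measure_ge_le (ε := ε * t) (by positivity)
  have h2 := h.neg.measure_ge_le (ε := ε * t) (by positivity)
  rw [he] at h1 h2
  calc _ ≤ _ := measureReal_mono hsub
    _ ≤ _ := measureReal_union_le _ _
    _ ≤ _ := by linarith

/-- Hoeffding's inequality for sums of a bounded function over an IID sample. -/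
theorem hoeffding_pi {E : Type*} [MeasurableSpace E] (M : Measure E) [IsProbabilityMeasure M]
    {φ : E → ℝ} (hφ : Measurable φ) {B : ℝ≥0} (hB : ∀ x, |φ x| ≤ B) (t : ℕ) {ε : ℝ} (hε : 0 ≤ ε) :
    (Measure.pi fun _ : Fin t => M).real {z | ε * t ≤ |∑ k, φ (z k) - t * ∫ x, φ x ∂M|} ≤
      2 * Real.exp (-(ε ^ 2 / (2 * (B ^ 2 : ℝ≥0))) * t) := by
  have h1 : HasSubgaussianMGF (fun x => φ x - ∫ x, φ x ∂M) (B ^ 2) M := by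
    have := hasSubgaussianMGF_of_mem_Icc (μ := M) hφ.aemeasurable
      (ae_of_all _ fun x => abs_le.1 (hB x))
    refine this.mono (le_of_eq ?_)
    -- The range $[-B,B]$ has length $2B$, and Hoeffding's lemma gives the proxy $(2B/2)^2=B^2$.
    have : ((B : ℝ) - -B) = ((2 * B : ℝ≥0) : ℝ) := by push_cast; ring
    rw [this, NNReal.nnnorm_eq]
    congr 1
    rw [mul_div_cancel_left₀]; simp
  have ind : iIndepFun (fun (k : Fin t) (z : Fin t → E) => φ (z k) - ∫ x, φ x ∂M)
      (Measure.pi fun _ : Fin t => M) :=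
    iIndepFun_pi (X := fun _ x => φ x - ∫ x, φ x ∂M) fun _ => (hφ.sub_const _).aemeasurable
  have hk : ∀ k : Fin t, HasSubgaussianMGF (fun z : Fin t → E => φ (z k) - ∫ x, φ x ∂M) (B ^ 2)
      (Measure.pi fun _ : Fin t => M) := fun k => by
    have hm := measurePreserving_eval (fun _ : Fin t => M) k
    rw [← hm.map_eq] at h1
    have := h1.of_map hm.measurable.aemeasurable
    rw [hm.map_eq] at this
    exact this
  have hs := HasSubgaussianMGF.sum_of_iIndepFun ind (s := Finset.univ) (fun k _ => hk k)
  simp only [Finset.sum_const, Finset.card_univ, Fintype.card_fin, nsmul_eq_mul] at hs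
  convert! hs.measureReal_abs_ge_le hε using 5
  simp

/-- Sums over vertex-disjoint ordered pairs of independent labels are sub-Gaussian. -/
theorem hasSubgaussianMGF_sum_pairs {Ω ι : Type*} [MeasurableSpace Ω] {μ : Measure Ω}
    [IsProbabilityMeasure μ] [DecidableEq ι] {a : ι → Ω → Bool} (ha : ∀ k, Measurable (a k))
    (hind : iIndepFun a μ) {s : ι → ι} (hs : Function.Involutive s) {v : Bool → Bool → ℝ}
    (hv : ∀ b c, v b c ∈ Set.Icc (0 : ℝ) 1) (A : Finset ι) (hA : ∀ k ∈ A, s k ∉ A) :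
    HasSubgaussianMGF (fun ω => ∑ k ∈ A,
      (v (a k ω) (a (s k) ω) - ∫ ω', v (a k ω') (a (s k) ω') ∂μ)) A.card μ := by
  induction A using Finset.induction_on with
  | empty => simp
  | insert j A hj ih =>
    have hmeas : ∀ k, Measurable fun ω => v (a k ω) (a (s k) ω) := fun k =>
      (measurable_of_countable (fun p : Bool × Bool => v p.1 p.2)).comp
        ((ha k).prodMk (ha (s k)))
    have h1 : HasSubgaussianMGF
        (fun ω => v (a j ω) (a (s j) ω) - ∫ ω', v (a j ω') (a (s j) ω') ∂μ) 1 μ := by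
      -- Hoeffding's lemma gives $1/4$ for range $[0,1]$; relaxing it to $1$ makes the proxy of the
      -- sum the number of pairs.
      refine (hasSubgaussianMGF_of_mem_Icc (μ := μ) (hmeas j).aemeasurable
        (ae_of_all _ fun ω => hv _ _)).mono ?_
      rw [← NNReal.coe_le_coe]; norm_num
    have h2 := ih fun k hk hk' =>
      hA k (Finset.mem_insert_of_mem hk) (Finset.mem_insert_of_mem hk')
    -- The new term reads only the labels at `j` and `s j`, none of which occurs in the earlier
    -- terms; independence follows.
    have hdisj : Disjoint ({j, s j} : Finset ι) (A ∪ A.image s) := by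
      rw [Finset.disjoint_left]
      have hsj : s j ∉ A := fun h => hA j (Finset.mem_insert_self _ _) (Finset.mem_insert_of_mem h)
      intro k hk hk'
      simp only [Finset.mem_insert, Finset.mem_singleton, Finset.mem_union, Finset.mem_image]
        at hk hk'
      rcases hk with rfl | rfl
      · rcases hk' with h | ⟨l, hl, rfl⟩
        · exact hj h
        · rw [hs] at hsj; exact hsj hl
      · rcases hk' with h | ⟨l, hl, h⟩
        · exact hsj h
        · rw [hs.injective h] at hl; exact hj hl
    have hI := hind.indepFun_finset _ _ hdisj ha
    have hI' : IndepFun (fun ω => v (a j ω) (a (s j) ω) - ∫ ω', v (a j ω') (a (s j) ω') ∂μ)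
        (fun ω => ∑ k ∈ A, (v (a k ω) (a (s k) ω) - ∫ ω', v (a k ω') (a (s k) ω') ∂μ)) μ := by
      have := hI.comp
        (φ := fun p => v (p ⟨j, by simp⟩) (p ⟨s j, by simp⟩) - ∫ ω', v (a j ω') (a (s j) ω') ∂μ)
        (ψ := fun p => ∑ k ∈ A.attach,
          (v (p ⟨k.1, Finset.mem_union_left _ k.2⟩)
              (p ⟨s k.1, Finset.mem_union_right _ (Finset.mem_image_of_mem s k.2)⟩) -
            ∫ ω', v (a k.1 ω') (a (s k.1) ω') ∂μ))
        (measurable_of_countable _) (measurable_of_countable _)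
      convert! this using 1
      ext ω
      simp only [Function.comp]
      rw [← Finset.sum_attach]
    have := h1.add_of_indepFun h2 hI'
    rw [Finset.card_insert_of_notMem hj]
    convert! this using 1
    · ext ω
      rw [Finset.sum_insert hj]
    · push_cast; rw [add_comm]

/-! ### Independent random labels. -/

/-- The law of a label that is `true` with probability `r`. -/
noncomputable def labelLaw (r : ℝ) : Measure Bool :=
  ENNReal.ofReal r • Measure.dirac true + ENNReal.ofReal (1 - r) • Measure.dirac false

theorem isProbabilityMeasure_labelLaw {r : ℝ} (h0 : 0 ≤ r) (h1 : r ≤ 1) :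
    IsProbabilityMeasure (labelLaw r) := by
  constructor
  simp only [labelLaw, Measure.add_apply, Measure.smul_apply, measure_univ, smul_eq_mul, mul_one]
  rw [← ENNReal.ofReal_add h0 (by linarith)]; simp

theorem labelLaw_singleton (r : ℝ) (b : Bool) :
    labelLaw r {b} = if b = true then ENNReal.ofReal r else ENNReal.ofReal (1 - r) := by
  cases b <;> simp [labelLaw]

theorem integral_pi_labelLaw_pair {ι : Type*} [Fintype ι] {r : ι → ℝ} (h0 : ∀ k, 0 ≤ r k)
    (h1 : ∀ k, r k ≤ 1) {k l : ι} (hkl : k ≠ l) :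
    ∫ ℓ, (if ℓ k = true ∧ ℓ l = false then (1 : ℝ) else 0) ∂(Measure.pi fun k => labelLaw (r k)) =
      r k * (1 - r l) := by
  have := fun k => isProbabilityMeasure_labelLaw (h0 k) (h1 k)
  have hind : iIndepFun (fun (k : ι) (ℓ : ι → Bool) => ℓ k) (Measure.pi fun k => labelLaw (r k)) :=
    iIndepFun_pi (X := fun _ b => b) fun _ => measurable_id.aemeasurable
  have hset : ∀ ℓ : ι → Bool, (if ℓ k = true ∧ ℓ l = false then (1 : ℝ) else 0) =
      ((fun ℓ : ι → Bool => ℓ k) ⁻¹' {true} ∩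
        (fun ℓ : ι → Bool => ℓ l) ⁻¹' {false}).indicator 1 ℓ := by
    intro ℓ
    by_cases h : ℓ k = true ∧ ℓ l = false
    · rw [if_pos h, Set.indicator_of_mem (show ℓ ∈ _ from h)]; rfl
    · rw [if_neg h, Set.indicator_of_notMem (show ℓ ∉ _ from h)]
  rw [integral_congr_ae (ae_of_all _ hset)]
  have hm : ∀ (k : ι) (b : Bool), MeasurableSet ((fun ℓ : ι → Bool => ℓ k) ⁻¹' {b}) := fun k b =>
    measurable_pi_apply k (measurableSet_singleton b)
  rw [integral_indicator_one ((hm k true).inter (hm l false)), Measure.real,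
    (hind.indepFun hkl).measure_inter_preimage_eq_mul _ _ (measurableSet_singleton _)
      (measurableSet_singleton _),
    (measurePreserving_eval (fun k => labelLaw (r k)) k).measure_preimage
      (measurableSet_singleton _).nullMeasurableSet,
    (measurePreserving_eval (fun k => labelLaw (r k)) l).measure_preimage
      (measurableSet_singleton _).nullMeasurableSet, labelLaw_singleton, labelLaw_singleton]
  simp [h0 k, h1 l]

/-- Concentration of the number of ordered pairs `(k, s k)` with labels `true`, `false`. -/
theorem measureReal_label_pairs_le {t : ℕ} {r : Fin t → ℝ} (h0 : ∀ k, 0 ≤ r k)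
    (h1 : ∀ k, r k ≤ 1) {s : Fin t → Fin t} (hs : Function.Involutive s) {ε : ℝ} (hε : 0 ≤ ε) :
    (Measure.pi fun k => labelLaw (r k)).real
      {ℓ | ε * t ≤ |∑ k, (if ℓ k = true ∧ ℓ (s k) = false then (1 : ℝ) else 0) -
        ∑ k, if s k = k then 0 else r k * (1 - r (s k))|} ≤
      4 * Real.exp (-(ε ^ 2 / 8) * t) := by
  have := fun k => isProbabilityMeasure_labelLaw (h0 k) (h1 k)
  set W := Measure.pi fun k => labelLaw (r k) with hW
  have hind : iIndepFun (fun (k : Fin t) (ℓ : Fin t → Bool) => ℓ k) W :=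
    iIndepFun_pi (X := fun _ b => b) fun _ => measurable_id.aemeasurable
  let D : Finset (Fin t) → (Fin t → Bool) → ℝ := fun A ℓ => ∑ k ∈ A,
    ((if ℓ k = true ∧ ℓ (s k) = false then (1 : ℝ) else 0) - r k * (1 - r (s k)))
  have bound : ∀ A : Finset (Fin t), (∀ k ∈ A, s k ∉ A) →
      W.real {ℓ | ε / 2 * t ≤ |D A ℓ|} ≤ 2 * Real.exp (-(ε ^ 2 / 8) * t) := fun A hA => by
    have hsub := hasSubgaussianMGF_sum_pairs (fun k => measurable_pi_apply k) hind hs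
      (v := fun b c => if b = true ∧ c = false then (1 : ℝ) else 0)
      (fun b c => by split_ifs <;> simp) A hA
    have hcard : (A.card : ℝ≥0) ≤ t * 1 := by
      rw [mul_one]; exact_mod_cast (Finset.card_le_univ A).trans_eq (Fintype.card_fin t)
    have hsub' := (hsub.mono hcard).measureReal_abs_ge_le (ε := ε / 2) (by positivity)
    have he : -((ε / 2) ^ 2 / (2 * ((1 : ℝ≥0) : ℝ))) * t = -(ε ^ 2 / 8) * t := by
      push_cast; ring
    rw [he] at hsub'
    have hD : ∀ ℓ, D A ℓ = ∑ k ∈ A, ((if ℓ k = true ∧ ℓ (s k) = false then (1 : ℝ) else 0) -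
        ∫ ℓ', (if ℓ' k = true ∧ ℓ' (s k) = false then (1 : ℝ) else 0) ∂W) := fun ℓ => by
      refine Finset.sum_congr rfl fun k hk => ?_
      rw [integral_pi_labelLaw_pair h0 h1]
      intro e
      exact hA k hk (e ▸ hk)
    simp only [hD]
    exact hsub'
  -- The terms at `k` and `s k` share their labels. Splitting by the order of `k` and `s k` leaves
  -- vertex-disjoint pairs; fixed points contribute zero.
  let A := Finset.univ.filter fun k => k < s k
  let B := Finset.univ.filter fun k => s k < k
  have hA := bound A fun k hk => by
    simp only [A, Finset.mem_filter, Finset.mem_univ, true_and, hs k] at hk ⊢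
    exact hk.le.not_gt
  have hB := bound B fun k hk => by
    simp only [B, Finset.mem_filter, Finset.mem_univ, true_and, hs k] at hk ⊢
    exact hk.le.not_gt
  have hsplit : ∀ ℓ : Fin t → Bool, ∑ k, (if ℓ k = true ∧ ℓ (s k) = false then (1 : ℝ) else 0) -
        ∑ k, (if s k = k then 0 else r k * (1 - r (s k))) = D A ℓ + D B ℓ := fun ℓ => by
    simp only [D, A, B]
    rw [← Finset.sum_sub_distrib, Finset.sum_filter, Finset.sum_filter, ← Finset.sum_add_distrib]
    refine Finset.sum_congr rfl fun k _ => ?_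
    rcases lt_trichotomy k (s k) with h | h | h
    · simp [h, h.ne', h.le]
    · rw [← h]; simp
    · simp [h, h.ne, h.le]
  have hsub : {ℓ | ε * t ≤ |∑ k, (if ℓ k = true ∧ ℓ (s k) = false then (1 : ℝ) else 0) -
        ∑ k, if s k = k then 0 else r k * (1 - r (s k))|} ⊆
      {ℓ | ε / 2 * t ≤ |D A ℓ|} ∪ {ℓ | ε / 2 * t ≤ |D B ℓ|} := by
    intro ℓ hℓ
    rw [Set.mem_ofPred_eq, hsplit] at hℓ
    by_contra hcon
    simp only [Set.mem_union, Set.mem_ofPred_eq, not_or, not_le] at hcon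
    linarith [abs_add_le (D A ℓ) (D B ℓ)]
  calc _ ≤ _ := measureReal_mono hsub
    _ ≤ _ := measureReal_union_le _ _
    _ ≤ _ := by linarith

/-! ### Replacing a partner's label probability by the point's own. -/

/-- If neighbours are mostly close to each other and `r` is close to the continuous `h`, then the
expected number of edges with distinct labels is close to the sum of `2 r (1 - r)`. -/
theorem abs_sum_mul_sub_le {E : Type*} [NormedAddCommGroup E] {t : ℕ} {r h : E → ℝ}
    (h0 : ∀ x, 0 ≤ r x) (h1 : ∀ x, r x ≤ 1) {B : ℝ} (hB : ∀ x, |h x| ≤ B) {ε δ R : ℝ}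
    (hδ : ∀ x y, ‖x - y‖ < δ → |h x - h y| ≤ ε) (hε : 0 ≤ ε)
    {z : Fin t → E} {s : Fin t → Fin t} (hs : Function.Involutive s)
    (hfix : ∀ k l, s k = k → s l = l → k = l) {C : ℕ}
    (hC : (Finset.univ.filter fun k => ‖z k‖ ≤ R ∧ ‖z (s k)‖ ≤ R ∧ δ ≤ ‖z k - z (s k)‖).card ≤ C) :
    |2 * ∑ k, (if s k = k then 0 else r (z k) * (1 - r (z (s k)))) -
        ∑ k, 2 * r (z k) * (1 - r (z k))| ≤
      4 * ∑ k, |r (z k) - h (z k)| + 2 * ε * t + 4 * B * C +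
        8 * B * (∑ k, (Metric.closedBall (0 : E) R)ᶜ.indicator (fun _ => (1 : ℝ)) (z k)) + 1 := by
  have hB0 : 0 ≤ B := (abs_nonneg _).trans (hB 0)
  let o : E → ℝ := (Metric.closedBall (0 : E) R)ᶜ.indicator (fun _ => (1 : ℝ))
  have o0 : ∀ x, 0 ≤ o x := fun x => Set.indicator_nonneg (fun _ _ => zero_le_one) x
  have o1 : ∀ x, R < ‖x‖ → o x = 1 := fun x hx =>
    Set.indicator_of_mem (by simpa using hx) _
  let lg : Fin t → ℝ := fun k =>
    if ‖z k‖ ≤ R ∧ ‖z (s k)‖ ≤ R ∧ δ ≤ ‖z k - z (s k)‖ then 1 else 0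
  have lg0 : ∀ k, 0 ≤ lg k := fun k => by simp only [lg]; split_ifs <;> simp
  have hlg : ∑ k, lg k ≤ C := by
    simp only [lg, Finset.sum_boole]
    exact_mod_cast hC
  let fx : Fin t → ℝ := fun k => if s k = k then 1 else 0
  have hfx : ∑ k, fx k ≤ 1 := by
    simp only [fx, Finset.sum_boole]
    have : (Finset.univ.filter fun k => s k = k).card ≤ 1 := Finset.card_le_one.2 fun a ha b hb =>
      hfix a b (by simpa using ha) (by simpa using hb)
    exact_mod_cast this
  have perm : ∀ F : Fin t → ℝ, ∑ k, F (s k) = ∑ k, F k := fun F =>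
    Equiv.sum_comp (hs.toPerm s) F
  -- Either the edge is short and uniform continuity applies, or it is long inside the ball or has
  -- an end outside it; then the trivial bound $2B$ is charged to `lg` or `o`.
  have hh : ∀ k, |h (z k) - h (z (s k))| ≤ ε + 2 * B * (lg k + o (z k) + o (z (s k))) := fun k => by
    have tr : |h (z k) - h (z (s k))| ≤ 2 * B := by
      have a1 := abs_le.1 (hB (z k)); have a2 := abs_le.1 (hB (z (s k)))
      exact abs_le.2 ⟨by linarith, by linarith⟩
    have big : 1 ≤ lg k + o (z k) + o (z (s k)) →
        |h (z k) - h (z (s k))| ≤ ε + 2 * B * (lg k + o (z k) + o (z (s k))) := fun hb => by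
      nlinarith
    have := lg0 k
    have := o0 (z k)
    have := o0 (z (s k))
    by_cases c1 : ‖z k - z (s k)‖ < δ
    · have := hδ _ _ c1
      have : 0 ≤ 2 * B * (lg k + o (z k) + o (z (s k))) := by positivity
      linarith
    by_cases c2 : R < ‖z k‖
    · exact big (by linarith [o1 _ c2])
    by_cases c3 : R < ‖z (s k)‖
    · exact big (by linarith [o1 _ c3])
    · refine big ?_
      have : lg k = 1 := if_pos ⟨not_lt.1 c2, not_lt.1 c3, not_lt.1 c1⟩
      linarith
  have term : ∀ k, |2 * (if s k = k then 0 else r (z k) * (1 - r (z (s k)))) -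
      2 * r (z k) * (1 - r (z k))| ≤ 2 * |r (z k) - h (z k)| + 2 * |r (z (s k)) - h (z (s k))| +
        2 * (ε + 2 * B * (lg k + o (z k) + o (z (s k)))) + fx k := fun k => by
    have i0 := h0 (z k)
    have i1 := h1 (z k)
    have a0 := abs_nonneg (r (z k) - h (z k))
    have a1 := abs_nonneg (r (z (s k)) - h (z (s k)))
    have a2 := (abs_nonneg _).trans (hh k)
    by_cases c : s k = k
    · have : fx k = 1 := if_pos c
      rw [if_pos c, this]
      have : |2 * (0 : ℝ) - 2 * r (z k) * (1 - r (z k))| ≤ 1 :=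
        abs_le.2 ⟨by nlinarith [sq_nonneg (2 * r (z k) - 1)], by nlinarith⟩
      linarith
    · have : fx k = 0 := if_neg c
      rw [if_neg c, this]
      have e : 2 * (r (z k) * (1 - r (z (s k)))) - 2 * r (z k) * (1 - r (z k)) =
          2 * r (z k) * ((r (z k) - h (z k)) + (h (z k) - h (z (s k))) +
            -(r (z (s k)) - h (z (s k)))) := by ring
      rw [e, abs_mul, abs_of_nonneg (by positivity : 0 ≤ 2 * r (z k))]
      have b := abs_add_three (r (z k) - h (z k)) (h (z k) - h (z (s k)))
        (-(r (z (s k)) - h (z (s k))))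
      rw [abs_neg] at b
      have := hh k
      have := abs_nonneg ((r (z k) - h (z k)) + (h (z k) - h (z (s k))) +
            -(r (z (s k)) - h (z (s k))))
      nlinarith
  rw [Finset.mul_sum, ← Finset.sum_sub_distrib]
  refine (Finset.abs_sum_le_sum_abs _ _).trans ((Finset.sum_le_sum fun k _ => term k).trans ?_)
  simp only [Finset.sum_add_distrib, ← Finset.mul_sum, Finset.sum_const, Finset.card_univ,
    Fintype.card_fin, nsmul_eq_mul]
  -- Since `s` permutes the indices, partner sums equal point sums; this doubles the coefficients of
  -- $|r-h|$ and `o`.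
  rw [perm fun k => |r (z k) - h (z k)|, perm fun k => o (z k)]
  change _ ≤ 4 * ∑ k, |r (z k) - h (z k)| + 2 * ε * t + 4 * B * C + 8 * B * (∑ k, o (z k)) + 1
  nlinarith

/-- The matching lives on the set of points, so it transfers to indices only when no two points
coincide; without atoms the diagonal is null. -/
theorem ae_injective_pi {E : Type*} [MeasurableSpace E] [MeasurableSingletonClass E]
    [MeasurableEq E] (M : Measure E)
    [IsProbabilityMeasure M] [NullSingletonClass M] (t : ℕ) :
    ∀ᵐ z ∂(Measure.pi fun _ : Fin t => M), Function.Injective z := by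
  have h : ∀ k l : Fin t, k ≠ l → ∀ᵐ z ∂(Measure.pi fun _ : Fin t => M), z k ≠ z l := by
    intro k l hkl
    have hind : iIndepFun (fun (k : Fin t) (z : Fin t → E) => z k)
        (Measure.pi fun _ : Fin t => M) :=
      iIndepFun_pi (X := fun _ b => b) fun _ => measurable_id.aemeasurable
    have hm := (hind.indepFun hkl).map_prod_eq_prod_map_map (measurable_pi_apply k).aemeasurable
      (measurable_pi_apply l).aemeasurable
    have e : ∀ k : Fin t, (Measure.pi fun _ : Fin t => M).map (fun z => z k) = M := fun k =>
      (measurePreserving_eval (fun _ : Fin t => M) k).map_eq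
    rw [e, e] at hm
    have hd : MeasurableSet {q : E × E | q.1 = q.2} := measurableSet_eq_fun measurable_fst measurable_snd
    have hz : (M.prod M) {q : E × E | q.1 = q.2} = 0 := by
      rw [Measure.measure_prod_null hd]
      refine ae_of_all _ fun x => ?_
      have : Prod.mk x ⁻¹' {q : E × E | q.1 = q.2} = {x} := by
        ext y; simp [eq_comm]
      change M (Prod.mk x ⁻¹' {q : E × E | q.1 = q.2}) = 0
      rw [this]; simp
    rw [← hm, Measure.map_apply ((measurable_pi_apply k).prodMk (measurable_pi_apply l)) hd] at hz
    rw [ae_iff]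
    simpa using hz
  have h' : ∀ᵐ z ∂(Measure.pi fun _ : Fin t => M), ∀ k l : Fin t, k ≠ l → z k ≠ z l :=
    ae_all_iff.2 fun k => ae_all_iff.2 fun l => by
      by_cases hkl : k = l
      · simp [hkl]
      · simpa [hkl] using h k l hkl
  filter_upwards [h'] with z hz k l hkl
  by_contra hne
  exact hz k l hne hkl

/-! ### Exponential deviation bound for independent labels. -/

set_option maxHeartbeats 1000000 in
open Classical in
/-- For an IID sample from `M`, labelled independently with probabilities `r`, the number of edges
of an optimal matching with distinct labels concentrates exponentially. -/
theorem exists_lintegral_label_deviation_le {E : Type*} [NormedAddCommGroup E] [ProperSpace E]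
    [MeasurableSpace E] [BorelSpace E] {M : Measure E} [IsProbabilityMeasure M]
    [NullSingletonClass M] {r : E → ℝ} (hr : Measurable r) (h0 : ∀ x, 0 ≤ r x) (h1 : ∀ x, r x ≤ 1)
    {lam : ℝ → ℝ} (hmono : MonotoneOn lam (Set.Ici 0)) (hpos : ∀ b, 0 < b → 0 < lam b)
    (hlim : Tendsto lam (𝓝[>] 0) (𝓝 0)) {ε : ℝ} (hε : 0 < ε) :
    ∃ K c : ℝ, 0 < c ∧ ∀ (t : ℕ) (H : Finset E → Digraph E),
      (∀ A : Finset E, ∃ σ : Equiv.Perm A, IsOptimalMatching lam σ ∧ H A = matchingGraph σ) →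
      ∫⁻ z, (Measure.pi fun k : Fin t => labelLaw (r (z k)))
        {ℓ | ε * t < |labelCrossings (H (Finset.univ.image z)) ℓ z -
          t * ∫ x, 2 * r x * (1 - r x) ∂M|} ∂(Measure.pi fun _ : Fin t => M) ≤
        ENNReal.ofReal (K * Real.exp (-c * t)) := by
  have hrI : Integrable r M := Integrable.of_mem_Icc 0 1 hr.aemeasurable
    (ae_of_all _ fun x => ⟨h0 x, h1 x⟩)
  -- The errors below total $30\varepsilon' t$: $2$ from the labels, $8+2+1+16$ from
  -- `abs_sum_mul_sub_le`, and $1$ from the points.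
  set ε' := ε / 40 with hε'
  have hε'0 : 0 < ε' := by positivity
  obtain ⟨h, hsupp, hle, hcont, -⟩ := hrI.exists_hasCompactSupport_integral_sub_le hε'0
  obtain ⟨B₀, hB₀⟩ := hsupp.exists_bound_of_continuous hcont
  set B : ℝ≥0 := ⟨max B₀ 0 + 1, by positivity⟩ with hBdef
  have hB1 : (1 : ℝ) ≤ B := by change 1 ≤ max B₀ 0 + 1; linarith [le_max_right B₀ 0]
  have hB : ∀ x, |h x| ≤ B := fun x => by
    change |h x| ≤ max B₀ 0 + 1
    have := hB₀ x
    rw [Real.norm_eq_abs] at this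
    linarith [le_max_left B₀ 0]
  obtain ⟨δ, hδ0, hδ⟩ := Metric.uniformContinuous_iff.1
    (hsupp.uniformContinuous_of_continuous hcont) ε' hε'0
  have hδ' : ∀ x y, ‖x - y‖ < δ → |h x - h y| ≤ ε' := fun x y hxy => by
    have := hδ (a := x) (b := y) (by rwa [dist_eq_norm])
    rw [Real.dist_eq] at this
    exact this.le
  have hBpos : (0 : ℝ) < B := by linarith
  -- The mass outside the ball is divided by `B` in advance, because it enters the final estimate
  -- multiplied by $8B$.
  obtain ⟨R, hR⟩ : ∃ R : ℝ, M.real (Metric.closedBall (0 : E) R)ᶜ ≤ ε' / B := by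
    obtain ⟨K, hK, hMK⟩ := isTightMeasureSet_iff_exists_isCompact_measure_compl_le.1
      (isTightMeasureSet_singleton (μ := M)) (ENNReal.ofReal (ε' / B))
      (ENNReal.ofReal_pos.2 (by positivity))
    obtain ⟨R, hR⟩ := hK.isBounded.subset_closedBall (0 : E)
    refine ⟨R, ENNReal.toReal_le_of_le_ofReal (by positivity) ?_⟩
    exact (measure_mono (Set.compl_subset_compl.2 hR)).trans (hMK M rfl)
  obtain ⟨C, hC⟩ := exists_card_long_edges_le (E := E) hmono hpos hlim R hδ0
  set o : E → ℝ := (Metric.closedBall (0 : E) R)ᶜ.indicator (fun _ => (1 : ℝ)) with ho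
  have homeas : Measurable o := measurable_const.indicator Metric.isClosed_closedBall.measurableSet.compl
  have hoint : ∫ x, o x ∂M ≤ ε' / B := by
    rw [ho, integral_indicator_const _ Metric.isClosed_closedBall.measurableSet.compl]
    simpa using hR
  set q : E → ℝ := fun x => 2 * r x * (1 - r x) with hq
  have hqmeas : Measurable q := by fun_prop
  set e : E → ℝ := fun x => |r x - h x| with he
  have hemeas : Measurable e := (hr.sub hcont.measurable).abs
  have heint : ∫ x, e x ∂M ≤ ε' := hle
  have ob : ∀ x, |o x| ≤ (1 : ℝ≥0) := fun x => by
    rw [ho, Set.indicator_apply]; split_ifs <;> simp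
  have qb : ∀ x, |q x| ≤ (1 : ℝ≥0) := fun x => by
    have i0 := h0 x
    have i1 := h1 x
    push_cast
    exact abs_le.2 ⟨by simp only [hq]; nlinarith, by
      simp only [hq]; nlinarith [sq_nonneg (2 * r x - 1)]⟩
  have eb : ∀ x, |e x| ≤ (B + 1 : ℝ≥0) := fun x => by
    have i0 := h0 x
    have i1 := h1 x
    push_cast
    simp only [he, abs_abs]
    have := abs_le.1 (hB x)
    exact abs_le.2 ⟨by linarith, by linarith⟩
  set c1 := ε' ^ 2 / (2 * (((1 : ℝ≥0) ^ 2 : ℝ≥0) : ℝ)) with hc1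
  set c2 := ε' ^ 2 / (2 * (((B + 1 : ℝ≥0) ^ 2 : ℝ≥0) : ℝ)) with hc2
  set c3 := (ε' / B) ^ 2 / (2 * (((1 : ℝ≥0) ^ 2 : ℝ≥0) : ℝ)) with hc3
  set c4 := ε' ^ 2 / 8 with hc4
  have c1p : 0 < c1 := by positivity
  have c2p : 0 < c2 := by positivity
  have c3p : 0 < c3 := by positivity
  have c4p : 0 < c4 := by positivity
  set c := min (min c1 c2) (min c3 c4) with hc
  have hcpos : 0 < c := lt_min (lt_min c1p c2p) (lt_min c3p c4p)
  have hexp : ∀ (a : ℝ) (t : ℕ), c ≤ a → Real.exp (-a * t) ≤ Real.exp (-c * t) := fun a t hct =>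
    Real.exp_le_exp.2 (by nlinarith [(Nat.cast_nonneg t : (0 : ℝ) ≤ t)])
  obtain ⟨t₀, ht₀⟩ := exists_nat_ge ((1 + 4 * B * C) / ε')
  -- The summand $10=6+4$ covers atypical points and atypical labels; the exponential makes the
  -- bound trivial for $t<t_0$.
  refine ⟨10 + Real.exp (c * t₀), c, hcpos, fun t H hH => ?_⟩
  have hprob : ∀ z : Fin t → E, IsProbabilityMeasure (Measure.pi fun k => labelLaw (r (z k))) :=
    fun z => by
      have := fun k => isProbabilityMeasure_labelLaw (h0 (z k)) (h1 (z k))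
      infer_instance
  by_cases ht : t < t₀
  · calc _ ≤ ∫⁻ z, 1 ∂(Measure.pi fun _ : Fin t => M) := lintegral_mono fun z => by
          have := hprob z
          exact prob_le_one
      _ = ENNReal.ofReal 1 := by simp
      _ ≤ _ := ENNReal.ofReal_le_ofReal ?_
    have : Real.exp (c * t₀) * Real.exp (-c * t) = Real.exp (c * (t₀ - t)) := by
      rw [← Real.exp_add]; congr 1; ring
    have h2 : 1 ≤ Real.exp (c * (t₀ - t)) := Real.one_le_exp
      (mul_nonneg hcpos.le (sub_nonneg.2 (by exact_mod_cast ht.le)))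
    have h3 := Real.exp_pos (-c * t)
    nlinarith
  have ht1 : 1 + 4 * B * C ≤ ε' * t := by
    have : (t₀ : ℝ) ≤ t := by exact_mod_cast not_lt.1 ht
    rw [div_le_iff₀ hε'0] at ht₀
    nlinarith
  set Mt := Measure.pi fun _ : Fin t => M with hMt
  let S1 := {z : Fin t → E | ε' * t ≤ |∑ k, q (z k) - t * ∫ x, q x ∂M|}
  let S2 := {z : Fin t → E | ε' * t ≤ |∑ k, e (z k) - t * ∫ x, e x ∂M|}
  let S3 := {z : Fin t → E | ε' / B * t ≤ |∑ k, o (z k) - t * ∫ x, o x ∂M|}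
  have summeas : ∀ φ : E → ℝ, Measurable φ → ∀ a b : ℝ,
      MeasurableSet {z : Fin t → E | a ≤ |∑ k, φ (z k) - b|} := fun φ hφ a b =>
    measurableSet_le measurable_const (by fun_prop)
  have m1 : MeasurableSet S1 := summeas q hqmeas _ _
  have m2 : MeasurableSet S2 := summeas e hemeas _ _
  have m3 : MeasurableSet S3 := summeas o homeas _ _
  have b1 : Mt.real S1 ≤ 2 * Real.exp (-c1 * t) := hoeffding_pi M hqmeas qb t hε'0.le
  have b2 : Mt.real S2 ≤ 2 * Real.exp (-c2 * t) := hoeffding_pi M hemeas eb t hε'0.le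
  have b3 : Mt.real S3 ≤ 2 * Real.exp (-c3 * t) :=
    hoeffding_pi M homeas ob t (div_nonneg hε'0.le hBpos.le)
  have bS : Mt.real (S1 ∪ S2 ∪ S3) ≤ 6 * Real.exp (-c * t) := by
    have := hexp c1 t ((min_le_left _ _).trans (min_le_left _ _))
    have := hexp c2 t ((min_le_left _ _).trans (min_le_right _ _))
    have := hexp c3 t ((min_le_right _ _).trans (min_le_left _ _))
    have u1 := measureReal_union_le (μ := Mt) (S1 ∪ S2) S3
    have u2 := measureReal_union_le (μ := Mt) S1 S2
    linarith
  have point : ∀ z : Fin t → E, Function.Injective z → z ∉ S1 ∪ S2 ∪ S3 →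
      (Measure.pi fun k : Fin t => labelLaw (r (z k)))
        {ℓ | ε * t < |labelCrossings (H (Finset.univ.image z)) ℓ z - t * ∫ x, q x ∂M|} ≤
        ENNReal.ofReal (4 * Real.exp (-c * t)) := fun z hz hS => by
    have := hprob z
    simp only [Set.mem_union, not_or, S1, S2, S3, Set.mem_ofPred_eq, not_le] at hS
    obtain ⟨⟨g1, g2⟩, g3⟩ := hS
    obtain ⟨σ, hσ, hHσ⟩ := hH (Finset.univ.image z)
    obtain ⟨s, hs, hfix, hadj, hcard⟩ := exists_index_involution hz hσ (hC _ σ hσ)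
    have hL := labelCrossings_eq_of_involutive (H := H (Finset.univ.image z)) (z := z) hs
      (by rw [hHσ]; exact hadj)
    have key := abs_sum_mul_sub_le h0 h1 hB hδ' hε'0.le hs hfix hcard
    have conc := measureReal_label_pairs_le (fun k => h0 (z k)) (fun k => h1 (z k)) hs hε'0.le
    have conc' := conc.trans (mul_le_mul_of_nonneg_left
      (hexp c4 t ((min_le_right _ _).trans (min_le_right _ _))) (by norm_num))
    rw [← ENNReal.ofReal_toReal (measure_ne_top _ _)]
    refine ENNReal.ofReal_le_ofReal ((measureReal_mono ?_).trans conc')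
    intro ℓ hℓ
    rw [Set.mem_ofPred_eq, hL] at hℓ
    rw [Set.mem_ofPred_eq]
    by_contra hcon
    rw [not_le] at hcon
    refine absurd hℓ (not_lt.2 ?_)
    change _ ≤ 4 * ∑ k, e (z k) + 2 * ε' * t + 4 * B * C + 8 * B * (∑ k, o (z k)) + 1 at key
    change |_ - ∑ k, q (z k)| ≤ _ at key
    have tnn : (0 : ℝ) ≤ t := Nat.cast_nonneg t
    have s2 : ∑ k, e (z k) ≤ 2 * ε' * t := by
      linarith [(abs_lt.1 g2).2, mul_le_mul_of_nonneg_left heint tnn]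
    have s3 : B * ∑ k, o (z k) ≤ 2 * ε' * t := by
      have h4 : ∑ k, o (z k) ≤ 2 * (ε' / B) * t := by
        linarith [(abs_lt.1 g3).2, mul_le_mul_of_nonneg_left hoint tnn]
      calc B * ∑ k, o (z k) ≤ B * (2 * (ε' / B) * t) := mul_le_mul_of_nonneg_left h4 hBpos.le
        _ = 2 * ε' * t := by field_simp
    have e40 : ε = 40 * ε' := by rw [hε']; ring
    rw [e40]
    have k1 := abs_le.1 key
    have k2 := abs_lt.1 hcon
    have k3 := abs_lt.1 g1
    exact abs_le.2 ⟨by linarith, by linarith⟩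
  calc _ ≤ ∫⁻ z, ((S1 ∪ S2 ∪ S3).indicator (fun _ => (1 : ℝ≥0∞)) z +
          ENNReal.ofReal (4 * Real.exp (-c * t))) ∂Mt := by
        refine lintegral_mono_ae ?_
        filter_upwards [ae_injective_pi M t] with z hz
        by_cases hS : z ∈ S1 ∪ S2 ∪ S3
        · rw [Set.indicator_of_mem hS]
          have := hprob z
          exact prob_le_one.trans le_self_add
        · exact (point z hz hS).trans le_add_self
    _ = Mt (S1 ∪ S2 ∪ S3) + ENNReal.ofReal (4 * Real.exp (-c * t)) := by
        rw [lintegral_add_right _ measurable_const, lintegral_indicator_const ((m1.union m2).union m3)]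
        simp
    _ ≤ ENNReal.ofReal (6 * Real.exp (-c * t)) + ENNReal.ofReal (4 * Real.exp (-c * t)) := by
        gcongr
        rw [← ENNReal.ofReal_toReal (measure_ne_top Mt _)]
        exact ENNReal.ofReal_le_ofReal bS
    _ ≤ _ := by
        rw [← ENNReal.ofReal_add (by positivity) (by positivity)]
        refine ENNReal.ofReal_le_ofReal ?_
        have := Real.exp_pos (-c * t)
        have := Real.exp_pos (c * t₀)
        nlinarith

/-! ### From random labels to fixed sample sizes. -/

theorem pi_withDensity_eq_withDensity_prod {ι E : Type*} [Fintype ι] [MeasurableSpace E]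
    (M : Measure E) [IsProbabilityMeasure M] {ρ : ι → E → ℝ≥0∞} (hρ : ∀ k, Measurable (ρ k))
    [∀ k, SigmaFinite (M.withDensity (ρ k))] :
    Measure.pi (fun k => M.withDensity (ρ k)) =
      (Measure.pi fun _ : ι => M).withDensity fun z => ∏ k, ρ k (z k) := by
  refine Measure.pi_eq fun s hs => ?_
  have hbox : MeasurableSet (Set.univ.pi s) := MeasurableSet.univ_pi hs
  rw [withDensity_apply _ hbox, ← lintegral_indicator hbox]
  have hmeas : ∀ k, Measurable ((s k).indicator (ρ k)) := fun k => (hρ k).indicator (hs k)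
  have hprod : ∀ z : ι → E, (Set.univ.pi s).indicator (fun z => ∏ k, ρ k (z k)) z =
      ∏ k, (s k).indicator (ρ k) (z k) := fun z => by
    by_cases hz : z ∈ Set.univ.pi s
    · rw [Set.indicator_of_mem hz]
      exact Finset.prod_congr rfl fun k _ => (Set.indicator_of_mem (hz k trivial) _).symm
    · rw [Set.indicator_of_notMem hz]
      simp only [Set.mem_pi, Set.mem_univ, true_imp_iff, not_forall] at hz
      obtain ⟨k, hk⟩ := hz
      exact (Finset.prod_eq_zero (Finset.mem_univ k) (Set.indicator_of_notMem hk _)).symm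
  rw [lintegral_congr hprod]
  refine (lintegral_prod_eq_prod_lintegral_of_indepFun (μ := Measure.pi fun _ : ι => M) Finset.univ
    (fun k z => (s k).indicator (ρ k) (z k))
    (iIndepFun_pi (X := fun k => (s k).indicator (ρ k)) fun k => (hmeas k).aemeasurable)
    (fun k => (hmeas k).comp (measurable_pi_apply k))).trans ?_
  refine Finset.prod_congr rfl fun k _ => ?_
  rw [withDensity_apply _ (hs k), ← lintegral_indicator (hs k),
    ← (measurePreserving_eval (fun _ : ι => M) k).lintegral_comp (hmeas k)]

/-- The law of a labelled point, up to normalisation, in terms of the mixture `M`. -/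
theorem prod_mul_pi_eq_withDensity {ι E : Type*} [Fintype ι] [MeasurableSpace E]
    {M : Measure E} [IsProbabilityMeasure M] {base : Bool → Measure E}
    [∀ b, IsProbabilityMeasure (base b)] {a : Bool → ℝ≥0∞} (ha : ∀ b, a b ≠ ∞)
    {ρ : Bool → E → ℝ≥0∞} (hρ : ∀ b, Measurable (ρ b))
    (hbase : ∀ b, a b • base b = M.withDensity (ρ b)) (ℓ : ι → Bool) :
    (∏ k, a (ℓ k)) • Measure.pi (fun k => base (ℓ k)) =
      (Measure.pi fun _ : ι => M).withDensity fun z => ∏ k, ρ (ℓ k) (z k) := by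
  have hfin : ∀ b, IsFiniteMeasure (M.withDensity (ρ b)) := fun b => by
    rw [← hbase]; exact (base b).smul_finite (ha b)
  have := fun k => hfin (ℓ k)
  rw [← pi_withDensity_eq_withDensity_prod M fun k => hρ (ℓ k)]
  refine (Measure.pi_eq fun s hs => ?_).symm
  rw [Measure.smul_apply, Measure.pi_pi, smul_eq_mul, ← Finset.prod_mul_distrib]
  refine Finset.prod_congr rfl fun k _ => ?_
  rw [← hbase]; rfl

theorem exists_perm_comp_eq {ι : Type*} [Fintype ι] [DecidableEq ι] {ℓ ℓ' : ι → Bool}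
    (h : (Finset.univ.filter fun k => ℓ k = true).card =
      (Finset.univ.filter fun k => ℓ' k = true).card) :
    ∃ e : Equiv.Perm ι, ℓ' ∘ e = ℓ := by
  have hc : Fintype.card {k // ℓ k = true} = Fintype.card {k // ℓ' k = true} := by
    rw [Fintype.card_subtype, Fintype.card_subtype, h]
  let e := Fintype.equivOfCardEq hc
  refine ⟨e.extendSubtype, funext fun k => ?_⟩
  by_cases hk : ℓ k = true
  · rw [Function.comp, hk]; exact e.extendSubtype_mem k hk
  · have := e.extendSubtype_not_mem k hk
    rw [Bool.not_eq_true] at hk this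
    rw [Function.comp, hk, this]

/-- Exchangeability: renaming coordinates carries one product law to the other and the event with
it, so all labellings with equally many `true` labels give the event the same probability. -/
theorem measure_pi_comp_perm {ι E : Type*} [Fintype ι] [MeasurableSpace E]
    {base : Bool → Measure E} [∀ b, IsProbabilityMeasure (base b)]
    {D : (ι → Bool) → Set (ι → E)} (hD : ∀ ℓ, MeasurableSet (D ℓ))
    (hequiv : ∀ (e : Equiv.Perm ι) ℓ z, z ∘ e ∈ D (ℓ ∘ e) ↔ z ∈ D ℓ) (ℓ : ι → Bool)
    (e : Equiv.Perm ι) :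
    Measure.pi (fun k => base (ℓ (e k))) (D (ℓ ∘ e)) = Measure.pi (fun k => base (ℓ k)) (D ℓ) := by
  have hm := measurePreserving_piCongrLeft (α := fun _ : ι => E) (fun k => base (ℓ k)) e
  rw [← hm.measure_preimage (hD ℓ).nullMeasurableSet]
  congr 1
  ext z
  rw [Set.mem_preimage, ← hequiv e ℓ]
  have : (MeasurableEquiv.piCongrLeft (fun _ : ι => E) e z) ∘ e = z := by
    ext k
    rw [Function.comp, MeasurableEquiv.coe_piCongrLeft, Equiv.piCongrLeft_apply_apply]
  rw [this]

/-- Passing from IID labels to a fixed number of labels of each kind costs at most the inverse of a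
binomial probability. -/
theorem choose_mul_measure_le_lintegral {E : Type*} [MeasurableSpace E] {t : ℕ}
    {M : Measure E} [IsProbabilityMeasure M] {base : Bool → Measure E}
    [∀ b, IsProbabilityMeasure (base b)] {a : Bool → ℝ≥0∞} (ha : ∀ b, a b ≠ ∞)
    {r : E → ℝ} (hr : Measurable r) (h0 : ∀ x, 0 ≤ r x) (h1 : ∀ x, r x ≤ 1)
    (hbase : ∀ b, a b • base b = M.withDensity fun x => labelLaw (r x) {b})
    {D : (Fin t → Bool) → Set (Fin t → E)} (hD : ∀ ℓ, MeasurableSet (D ℓ))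
    (hequiv : ∀ (e : Equiv.Perm (Fin t)) ℓ z, z ∘ e ∈ D (ℓ ∘ e) ↔ z ∈ D ℓ) (ℓ₀ : Fin t → Bool)
    {m : ℕ} (hm : (Finset.univ.filter fun k => ℓ₀ k = true).card = m) :
    t.choose m * ((∏ k, a (ℓ₀ k)) * Measure.pi (fun k => base (ℓ₀ k)) (D ℓ₀)) ≤
      ∫⁻ z, (Measure.pi fun k => labelLaw (r (z k))) {ℓ | z ∈ D ℓ} ∂(Measure.pi fun _ => M) := by
  classical
  let L : Finset (Fin t) → Fin t → Bool := fun S k => decide (k ∈ S)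
  have Linj : Function.Injective L := fun S T h => by
    ext k
    simpa [L] using congrFun h k
  have hρ : ∀ b, Measurable fun x => labelLaw (r x) {b} := fun b => by
    simp only [labelLaw_singleton]
    cases b
    · simpa using (measurable_const.sub hr).ennreal_ofReal
    · simpa using hr.ennreal_ofReal
  have hρm : ∀ ℓ : Fin t → Bool, Measurable fun z : Fin t → E => ∏ k, labelLaw (r (z k)) {ℓ k} :=
    fun ℓ => Finset.measurable_fun_prod _ fun k _ => (hρ (ℓ k)).comp (measurable_pi_apply k)
  set Mt := Measure.pi fun _ : Fin t => M with hMt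
  -- By Bayes' rule `hbase`, each right-hand side is the probability that the labelling is `L S` and
  -- the event occurs; by exchangeability it does not depend on `S`.
  have hS : ∀ S ∈ Finset.powersetCard m (Finset.univ : Finset (Fin t)),
      (∏ k, a (ℓ₀ k)) * Measure.pi (fun k => base (ℓ₀ k)) (D ℓ₀) =
        ∫⁻ z, (D (L S)).indicator (fun z => ∏ k, labelLaw (r (z k)) {L S k}) z ∂Mt := by
    intro S hS
    obtain ⟨e, he⟩ := exists_perm_comp_eq (ℓ := L S) (ℓ' := ℓ₀) (by
      rw [hm, ← (Finset.mem_powersetCard.1 hS).2]; simp [L])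
    rw [lintegral_indicator (hD _), ← withDensity_apply _ (hD _),
      ← prod_mul_pi_eq_withDensity ha hρ hbase, Measure.smul_apply, smul_eq_mul, ← he,
      ← measure_pi_comp_perm hD hequiv ℓ₀ e]
    congr 1
    exact (Equiv.prod_comp e fun k => a (ℓ₀ k)).symm
  have hcount : (t.choose m : ℝ≥0∞) *
      ((∏ k, a (ℓ₀ k)) * Measure.pi (fun k => base (ℓ₀ k)) (D ℓ₀)) =
      ∑ S ∈ Finset.powersetCard m (Finset.univ : Finset (Fin t)),
        ∫⁻ z, (D (L S)).indicator (fun z => ∏ k, labelLaw (r (z k)) {L S k}) z ∂Mt := by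
    rw [← Finset.sum_congr rfl hS, Finset.sum_const, Finset.card_powersetCard, Finset.card_univ,
      Fintype.card_fin, nsmul_eq_mul]
  rw [hcount, ← lintegral_finsetSum _ fun S _ => (hρm (L S)).indicator (hD _)]
  -- Labellings with another number of `true` labels are discarded, which only lowers the
  -- probability.
  refine lintegral_mono fun z => ?_
  have := fun k => isProbabilityMeasure_labelLaw (h0 (z k)) (h1 (z k))
  have hterm : ∀ S, (D (L S)).indicator (fun z => ∏ k, labelLaw (r (z k)) {L S k}) z =
      if z ∈ D (L S) then (Measure.pi fun k => labelLaw (r (z k))) {L S} else 0 := fun S => by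
    rw [Set.indicator_apply, Measure.pi_singleton]
  simp only [hterm]
  rw [← Finset.sum_filter, ← Finset.sum_image (f := fun ℓ =>
    (Measure.pi fun k => labelLaw (r (z k))) {ℓ}) Linj.injOn, sum_measure_singleton]
  refine measure_mono fun ℓ hℓ => ?_
  simp only [Finset.coe_image, Set.mem_image, Finset.mem_coe, Finset.mem_filter] at hℓ
  obtain ⟨S, hS, rfl⟩ := hℓ
  exact hS.2

/-- The Poisson weight $m^k/k!$ is largest at $k=m$. -/
theorem factorial_mul_pow_le_factorial_mul_pow (m k : ℕ) :
    m.factorial * m ^ k ≤ k.factorial * m ^ m := by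
  rcases le_total k m with h | h
  · obtain ⟨j, rfl⟩ := Nat.exists_eq_add_of_le h
    have h2 : (k + j).factorial ≤ k.factorial * (k + j) ^ j := by
      rw [← Nat.factorial_mul_descFactorial (Nat.le_add_left j k), Nat.add_sub_cancel]
      exact Nat.mul_le_mul_left _ (Nat.descFactorial_le_pow _ _)
    calc _ ≤ k.factorial * (k + j) ^ j * (k + j) ^ k := Nat.mul_le_mul_right _ h2
      _ = _ := by rw [mul_assoc, ← pow_add, add_comm j k]
  · calc m.factorial * m ^ k = m.factorial * m ^ (k - m) * m ^ m := by
          rw [mul_assoc, ← pow_add, Nat.sub_add_cancel h]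
      _ ≤ _ := Nat.mul_le_mul_right _ (Nat.factorial_mul_pow_sub_le_factorial h)

/-- The binomial expansion of $(m+n)^{m+n}$ has $m+n+1$ terms, the largest being the one at $k=m$.
-/
theorem pow_add_le_succ_mul_choose_mul (m n : ℕ) :
    (m + n) ^ (m + n) ≤ (m + n + 1) * ((m + n).choose m * (m ^ m * n ^ n)) := by
  rw [add_pow]
  have hterm : ∀ k ∈ Finset.range (m + n + 1),
      m ^ k * n ^ (m + n - k) * (m + n).choose k ≤ (m + n).choose m * (m ^ m * n ^ n) := by
    intro k hk
    have hk' : k ≤ m + n := Nat.lt_succ_iff.1 (Finset.mem_range.1 hk)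
    set l := m + n - k with hl
    have h1 := factorial_mul_pow_le_factorial_mul_pow m k
    have h2 := factorial_mul_pow_le_factorial_mul_pow n l
    have c1 := Nat.choose_mul_factorial_mul_factorial hk'
    have c2 := Nat.choose_mul_factorial_mul_factorial (Nat.le_add_right m n)
    rw [Nat.add_sub_cancel_left] at c2
    have hpos : 0 < m.factorial * n.factorial * (k.factorial * l.factorial) := by positivity
    refine Nat.le_of_mul_le_mul_right ?_ hpos
    calc m ^ k * n ^ l * (m + n).choose k * (m.factorial * n.factorial * (k.factorial * l.factorial))
        = (m.factorial * m ^ k) * (n.factorial * n ^ l) *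
          ((m + n).choose k * k.factorial * l.factorial) := by ring
      _ ≤ (k.factorial * m ^ m) * (l.factorial * n ^ n) *
          ((m + n).choose k * k.factorial * l.factorial) := by gcongr
      _ = (k.factorial * m ^ m) * (l.factorial * n ^ n) *
          ((m + n).choose m * m.factorial * n.factorial) := by rw [c1, c2]
      _ = _ := by ring
  refine (Finset.sum_le_sum hterm).trans ?_
  simp

/-- A lower bound for a binomial probability close to its mode. -/
theorem pow_le_succ_mul_choose_mul {p x : ℝ} (hx : 0 ≤ x) {m n : ℕ} (hpos : 0 < m + n)
    (hm : x * (m / (m + n : ℝ)) ≤ p) (hn : x * (n / (m + n : ℝ)) ≤ 1 - p) :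
    x ^ (m + n) ≤ (m + n + 1) * ((m + n).choose m * (p ^ m * (1 - p) ^ n)) := by
  have ht : (0 : ℝ) < m + n := by exact_mod_cast hpos
  have h := pow_add_le_succ_mul_choose_mul m n
  have h' : ((m : ℝ) + n) ^ (m + n) ≤ (m + n + 1) * ((m + n).choose m * (m ^ m * n ^ n)) := by
    exact_mod_cast h
  -- Replacing the empirical frequencies by `p` and `1 - p` costs at most a factor `x` per point.
  have e1 : x ^ m * (m : ℝ) ^ m ≤ p ^ m * (m + n : ℝ) ^ m := by
    rw [← mul_pow, ← mul_pow]
    refine pow_le_pow_left₀ (by positivity) ?_ _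
    rw [← mul_div_assoc, div_le_iff₀ ht] at hm; exact hm
  have e2 : x ^ n * (n : ℝ) ^ n ≤ (1 - p) ^ n * (m + n : ℝ) ^ n := by
    rw [← mul_pow, ← mul_pow]
    refine pow_le_pow_left₀ (by positivity) ?_ _
    rw [← mul_div_assoc, div_le_iff₀ ht] at hn; exact hn
  have hp0 : 0 ≤ p := le_trans (by positivity) hm
  have hxn : 0 ≤ x ^ (m + n) := by positivity
  refine le_of_mul_le_mul_right ?_ (show 0 < ((m : ℝ) + n) ^ (m + n) by positivity)
  calc x ^ (m + n) * ((m : ℝ) + n) ^ (m + n)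
      ≤ x ^ (m + n) * ((m + n + 1) * ((m + n).choose m * (m ^ m * n ^ n))) := by gcongr
    _ = (m + n + 1) * ((m + n).choose m * ((x ^ m * (m : ℝ) ^ m) * (x ^ n * (n : ℝ) ^ n))) := by
        rw [pow_add]; ring
    _ ≤ (m + n + 1) * ((m + n).choose m * ((p ^ m * (m + n : ℝ) ^ m) *
          ((1 - p) ^ n * (m + n : ℝ) ^ n))) := by gcongr
    _ = _ := by rw [pow_add]; ring

open Classical in
theorem measurable_labelCrossings {T E ι : Type*} [Fintype ι] [MeasurableSpace T]
    {H : T → Digraph E} {z : T → ι → E}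
    (h : ∀ i j, MeasurableSet {q : T | (H q).Adj (z q i) (z q j)}) (ℓ : ι → Bool) :
    Measurable fun q => labelCrossings (H q) ℓ (z q) := by
  unfold labelCrossings
  refine Finset.measurable_fun_sum _ fun k _ => Finset.measurable_fun_sum _ fun l _ => ?_
  split_ifs with hkl
  · exact (Measurable.ite (h k l) measurable_const measurable_const).add
      (Measurable.ite (h l k) measurable_const measurable_const)
  · exact measurable_const

theorem filter_append_true_card (m n : ℕ) :
    (Finset.univ.filter fun k => Fin.append (fun _ : Fin m => true) (fun _ : Fin n => false) k
      = true).card = m := by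
  rw [Finset.card_filter, Fin.sum_univ_add]
  simp only [Fin.append_left, Fin.append_right]
  simp

open Classical in
/-- Exponential deviation bound for `m` points of law `base true` and `n` points of law
`base false`, when `m / (m + n)` is close to the mixture weight `p`. -/
theorem exists_measure_deviation_le {E : Type*} [NormedAddCommGroup E] [ProperSpace E]
    [MeasurableSpace E] [BorelSpace E] {M : Measure E} [IsProbabilityMeasure M]
    [NullSingletonClass M] {base : Bool → Measure E} [∀ b, IsProbabilityMeasure (base b)]
    {p : ℝ} (hp0 : 0 < p) (hp1 : p < 1)
    {r : E → ℝ} (hr : Measurable r) (h0 : ∀ x, 0 ≤ r x) (h1 : ∀ x, r x ≤ 1)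
    (hbase : ∀ b, (if b = true then ENNReal.ofReal p else ENNReal.ofReal (1 - p)) • base b =
      M.withDensity fun x => labelLaw (r x) {b})
    {lam : ℝ → ℝ} (hmono : MonotoneOn lam (Set.Ici 0)) (hpos : ∀ b, 0 < b → 0 < lam b)
    (hlim : Tendsto lam (𝓝[>] 0) (𝓝 0)) {ε : ℝ} (hε : 0 < ε) :
    ∃ K c : ℝ, 0 ≤ K ∧ 0 < c ∧ ∀ (m n : ℕ), 0 < m + n →
      Real.exp (-c) * (m / (m + n : ℝ)) ≤ p → Real.exp (-c) * (n / (m + n : ℝ)) ≤ 1 - p →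
      ∀ H : Finset E → Digraph E,
      (∀ A : Finset E, ∃ σ : Equiv.Perm A, IsOptimalMatching lam σ ∧ H A = matchingGraph σ) →
      (∀ i j, MeasurableSet {z : Fin (m + n) → E | (H (Finset.univ.image z)).Adj (z i) (z j)}) →
      Measure.pi (fun k : Fin (m + n) =>
          base (Fin.append (fun _ : Fin m => true) (fun _ : Fin n => false) k))
        {z | ε * (m + n : ℕ) < |labelCrossings (H (Finset.univ.image z))
          (Fin.append (fun _ : Fin m => true) (fun _ : Fin n => false)) z -
          (m + n : ℕ) * ∫ x, 2 * r x * (1 - r x) ∂M|} ≤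
        ENNReal.ofReal (K * ((m + n + 1) * Real.exp (-c) ^ (m + n))) := by
  obtain ⟨K, c, hc, hK⟩ := exists_lintegral_label_deviation_le (M := M) hr h0 h1 hmono hpos hlim hε
  -- Half of the rate pays for the binomial probability, the other half remains.
  refine ⟨|K|, c / 2, abs_nonneg _, half_pos hc, fun m n hmn hm hn H hH hHm => ?_⟩
  have hp1' : 0 < 1 - p := by linarith
  set ℓ₀ := Fin.append (fun _ : Fin m => true) (fun _ : Fin n => false) with hℓ₀
  let D : (Fin (m + n) → Bool) → Set (Fin (m + n) → E) := fun ℓ =>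
    {z | ε * (m + n : ℕ) < |labelCrossings (H (Finset.univ.image z)) ℓ z -
          (m + n : ℕ) * ∫ x, 2 * r x * (1 - r x) ∂M|}
  have hD : ∀ ℓ, MeasurableSet (D ℓ) := fun ℓ => by
    have := measurable_labelCrossings (H := fun z : Fin (m + n) → E => H (Finset.univ.image z))
      (z := fun z => z) hHm ℓ
    exact measurableSet_lt measurable_const (this.sub_const _).abs
  have hequiv : ∀ (e : Equiv.Perm (Fin (m + n))) ℓ z, z ∘ e ∈ D (ℓ ∘ e) ↔ z ∈ D ℓ := by
    intro e ℓ z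
    have himg : Finset.univ.image (z ∘ e) = Finset.univ.image z := by
      rw [← Finset.image_image, Finset.image_univ_equiv]
    simp only [D, Set.mem_ofPred_eq, himg, labelCrossings_comp_equiv]
  have key := (choose_mul_measure_le_lintegral (M := M) (base := base)
    (a := fun b => if b = true then ENNReal.ofReal p else ENNReal.ofReal (1 - p))
    (fun b => by split_ifs <;> exact ENNReal.ofReal_ne_top) hr h0 h1 hbase hD hequiv ℓ₀
    (filter_append_true_card m n)).trans (hK (m + n) H hH)
  have hprod : ∏ k, (if ℓ₀ k = true then ENNReal.ofReal p else ENNReal.ofReal (1 - p)) =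
      ENNReal.ofReal (p ^ m * (1 - p) ^ n) := by
    rw [hℓ₀, Fin.prod_univ_add]
    simp only [Fin.append_left, Fin.append_right]
    rw [ENNReal.ofReal_mul (by positivity), ENNReal.ofReal_pow hp0.le, ENNReal.ofReal_pow hp1'.le]
    simp
  rw [hprod] at key
  change Measure.pi (fun k => base (ℓ₀ k)) (D ℓ₀) ≤ _
  rw [← ENNReal.ofReal_toReal (measure_ne_top (Measure.pi fun k => base (ℓ₀ k)) (D ℓ₀))] at key ⊢
  set π := (Measure.pi (fun k => base (ℓ₀ k)) (D ℓ₀)).toReal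
  have hπ : 0 ≤ π := ENNReal.toReal_nonneg
  rw [← ENNReal.ofReal_natCast, ← ENNReal.ofReal_mul (by positivity),
    ← ENNReal.ofReal_mul (by positivity)] at key
  have hle : ((m + n).choose m : ℝ) * (p ^ m * (1 - p) ^ n * π) ≤
      |K| * Real.exp (-c * (m + n : ℕ)) := by
    have h2 : ENNReal.ofReal (((m + n).choose m : ℝ) * (p ^ m * (1 - p) ^ n * π)) ≤
        ENNReal.ofReal (|K| * Real.exp (-c * (m + n : ℕ))) :=
      key.trans (ENNReal.ofReal_le_ofReal
        (mul_le_mul_of_nonneg_right (le_abs_self K) (Real.exp_pos _).le))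
    exact (ENNReal.ofReal_le_ofReal_iff (by positivity)).1 h2
  refine ENNReal.ofReal_le_ofReal ?_
  have hx := pow_le_succ_mul_choose_mul (Real.exp_pos (-(c / 2))).le hmn hm hn
  set x := Real.exp (-(c / 2)) ^ (m + n) with hxdef
  have hxpos : 0 < x := by positivity
  have hxx : Real.exp (-c * (m + n : ℕ)) = x * x := by
    rw [hxdef, ← Real.exp_nat_mul, ← Real.exp_add]; congr 1; ring
  rw [hxx] at hle
  refine le_of_mul_le_mul_left ?_ hxpos
  calc x * π ≤ ((m + n + 1) * ((m + n).choose m * (p ^ m * (1 - p) ^ n))) * π := by gcongr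
    _ = (m + n + 1) * (((m + n).choose m : ℝ) * (p ^ m * (1 - p) ^ n * π)) := by ring
    _ ≤ (m + n + 1) * (|K| * (x * x)) := by gcongr
    _ = _ := by ring

/-! ### Borel–Cantelli over all pairs of sample sizes. -/

/-- Summing over all pairs $(m,n)$, not along the given sequence, allows $m+n$ to grow arbitrarily
slowly and pairs to repeat. -/
theorem tsum_pair_ne_top {K x : ℝ} (hK : 0 ≤ K) (hx0 : 0 ≤ x) (hx1 : x < 1) :
    ∑' q : ℕ × ℕ, ENNReal.ofReal (K * ((q.1 + q.2 + 1) * x ^ (q.1 + q.2))) ≠ ∞ := by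
  have hs : Summable fun n : ℕ => ((n : ℝ) + 1) * x ^ n := by
    have h1 : Summable fun n : ℕ => (n : ℝ) * x ^ n := by
      simpa using summable_pow_mul_geometric_of_norm_lt_one 1
        (show ‖x‖ < 1 by rwa [Real.norm_of_nonneg hx0])
    have h2 := summable_geometric_of_lt_one hx0 hx1
    simpa [add_mul] using h1.add h2
  have hp := (hs.mul_of_nonneg hs (fun n => by positivity) (fun n => by positivity)).mul_left K
  have hle : ∀ q : ℕ × ℕ, K * ((q.1 + q.2 + 1) * x ^ (q.1 + q.2)) ≤
      K * (((q.1 : ℝ) + 1) * x ^ q.1 * (((q.2 : ℝ) + 1) * x ^ q.2)) := fun q => by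
    refine mul_le_mul_of_nonneg_left ?_ hK
    have : ((q.1 : ℝ) + 1) * x ^ q.1 * (((q.2 : ℝ) + 1) * x ^ q.2) =
      ((q.1 + 1) * (q.2 + 1)) * x ^ (q.1 + q.2) := by rw [pow_add]; ring
    rw [this]
    refine mul_le_mul_of_nonneg_right ?_ (by positivity)
    have : (0 : ℝ) ≤ q.1 * q.2 := by positivity
    linarith
  have := Summable.of_nonneg_of_le (fun q => by positivity) hle hp
  rw [← ENNReal.ofReal_tsum_of_nonneg (fun q => by positivity) this]
  exact ENNReal.ofReal_ne_top

/-- The joint law of an independent seed and of the combined sample. -/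
theorem map_seed_append_eq {E Ω S : Type*} [MeasurableSpace E] [MeasurableSpace Ω]
    [MeasurableSpace S] {P : Measure Ω} [IsProbabilityMeasure P] {X Y : ℕ → Ω → E} {U : Ω → S}
    (hX : ∀ i, Measurable (X i)) (hY : ∀ j, Measurable (Y j)) (hU : Measurable U)
    {base : Bool → Measure E}
    (hXf : ∀ i, P.map (X i) = base true) (hYg : ∀ j, P.map (Y j) = base false)
    (hXY : iIndepFun (Sum.elim X Y) P)
    (hind : IndepFun U (fun ω => (fun i => X i ω, fun j => Y j ω)) P) (m n : ℕ) :
    P.map (fun ω => (U ω, Fin.append (fun i : Fin m => X i ω) (fun j : Fin n => Y j ω))) =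
      (P.map U).prod (Measure.pi fun k : Fin (m + n) =>
        base (Fin.append (fun _ : Fin m => true) (fun _ : Fin n => false) k)) := by
  let g : Fin (m + n) → ℕ ⊕ ℕ := Fin.append (fun i : Fin m => Sum.inl (i : ℕ))
    (fun j : Fin n => Sum.inr (j : ℕ))
  have hg : Function.Injective g := by
    intro k l
    refine Fin.addCases (fun i => ?_) (fun i => ?_) k <;>
      refine Fin.addCases (fun j => ?_) (fun j => ?_) l <;>
      simp only [g, Fin.append_left, Fin.append_right, Sum.inl.injEq, Sum.inr.injEq, reduceCtorEq,
        false_imp_iff] <;> intro h <;> rw [Fin.ext h]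
  have hZ : ∀ ω, Fin.append (fun i : Fin m => X i ω) (fun j : Fin n => Y j ω) =
      fun k => Sum.elim X Y (g k) ω := fun ω => by
    ext k
    refine Fin.addCases (fun i => ?_) (fun j => ?_) k
    · rw [Fin.append_left]; simp only [g]; rw [Fin.append_left]; rfl
    · rw [Fin.append_right]; simp only [g]; rw [Fin.append_right]; rfl
  have hmeas : ∀ a, Measurable (Sum.elim X Y a) := fun a => by cases a <;> simp [hX, hY]
  have hlaw : P.map (fun ω => Fin.append (fun i : Fin m => X i ω) (fun j : Fin n => Y j ω)) =
      Measure.pi fun k : Fin (m + n) =>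
        base (Fin.append (fun _ : Fin m => true) (fun _ : Fin n => false) k) := by
    simp only [hZ]
    rw [(hXY.precomp hg).map_fun_eq_pi_map fun k => (hmeas (g k)).aemeasurable]
    congr 1
    ext1 k
    refine Fin.addCases (fun i => ?_) (fun j => ?_) k
    · simp only [g]; rw [Fin.append_left, Fin.append_left]; exact hXf i
    · simp only [g]; rw [Fin.append_right, Fin.append_right]; exact hYg j
  have hφ : Measurable fun q : (ℕ → E) × (ℕ → E) =>
      Fin.append (fun i : Fin m => q.1 i) (fun j : Fin n => q.2 j) := by
    refine measurable_pi_lambda _ fun k => ?_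
    refine Fin.addCases (fun i => ?_) (fun j => ?_) k
    · simp only [Fin.append_left]; exact (measurable_pi_apply _).comp measurable_fst
    · simp only [Fin.append_right]; exact (measurable_pi_apply _).comp measurable_snd
  have hI := hind.comp measurable_id hφ
  have hXYm : Measurable fun ω => ((fun i => X i ω, fun j => Y j ω) : (ℕ → E) × (ℕ → E)) :=
    (measurable_pi_lambda _ hX).prodMk (measurable_pi_lambda _ hY)
  rw [← hlaw]
  exact hI.map_prod_eq_prod_map_map hU.aemeasurable (hφ.comp hXYm).aemeasurable

open Classical in
theorem ae_tendsto_crossCount {E : Type*} [NormedAddCommGroup E] [ProperSpace E]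
    [MeasurableSpace E] [BorelSpace E] {M : Measure E} [IsProbabilityMeasure M]
    [NullSingletonClass M] {base : Bool → Measure E} [∀ b, IsProbabilityMeasure (base b)]
    {p : ℝ} (hp0 : 0 < p) (hp1 : p < 1)
    {r : E → ℝ} (hr : Measurable r) (h0 : ∀ x, 0 ≤ r x) (h1 : ∀ x, r x ≤ 1)
    (hbase : ∀ b, (if b = true then ENNReal.ofReal p else ENNReal.ofReal (1 - p)) • base b =
      M.withDensity fun x => labelLaw (r x) {b})
    {lam : ℝ → ℝ} (hmono : MonotoneOn lam (Set.Ici 0)) (hpos : ∀ b, 0 < b → 0 < lam b)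
    (hlim : Tendsto lam (𝓝[>] 0) (𝓝 0))
    {Ω S : Type*} [MeasurableSpace Ω]
    [MeasurableSpace S] {P : Measure Ω} [IsProbabilityMeasure P] {X Y : ℕ → Ω → E} {U : Ω → S}
    (hX : ∀ i, Measurable (X i)) (hY : ∀ j, Measurable (Y j)) (hU : Measurable U)
    (hXf : ∀ i, P.map (X i) = base true) (hYg : ∀ j, P.map (Y j) = base false)
    (hXY : iIndepFun (Sum.elim X Y) P)
    (hind : IndepFun U (fun ω => (fun i => X i ω, fun j => Y j ω)) P)
    {m n : ℕ → ℕ} (hmn : Tendsto (fun k => m k + n k) atTop atTop)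
    (hp : Tendsto (fun k => (m k : ℝ) / ((m k : ℝ) + (n k : ℝ))) atTop (𝓝 p))
    {G : S → Finset E → Digraph E} (hG : IsOptimalMatchingConstruction lam G) :
    ∀ᵐ ω ∂P, Tendsto
      (fun k => (crossCount
        (G (U ω) (combinedSample (m k) (n k) (fun i => X i ω) (fun j => Y j ω)))
        (m k) (n k) (fun i => X i ω) (fun j => Y j ω) : ℝ) / ((m k : ℝ) + (n k : ℝ)))
      atTop (𝓝 (∫ x, 2 * r x * (1 - r x) ∂M)) := by
  set I := ∫ x, 2 * r x * (1 - r x) ∂M with hI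
  let χ : ℕ → ℕ → Ω → ℝ := fun a b ω =>
    (crossCount (G (U ω) (combinedSample a b (fun i => X i ω) (fun j => Y j ω))) a b
      (fun i => X i ω) (fun j => Y j ω) : ℝ)
  suffices H : ∀ N : ℕ, ∀ᵐ ω ∂P, ∀ᶠ k in atTop,
      |χ (m k) (n k) ω / ((m k : ℝ) + (n k : ℝ)) - I| ≤ 1 / ((N : ℝ) + 1) by
    filter_upwards [ae_all_iff.2 H] with ω hω
    rw [Metric.tendsto_nhds]
    intro ε hε
    obtain ⟨N, hN⟩ := exists_nat_one_div_lt hε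
    filter_upwards [hω N] with k hk
    rw [Real.dist_eq]
    exact hk.trans_lt hN
  intro N
  set ε : ℝ := 1 / ((N : ℝ) + 1) with hεdef
  have hε : 0 < ε := by positivity
  obtain ⟨K, c, hK0, hc, hK⟩ :=
    exists_measure_deviation_le hp0 hp1 hr h0 h1 hbase hmono hpos hlim hε
  have hx1 : Real.exp (-c) < 1 := by rw [Real.exp_lt_one_iff]; linarith
  -- Outside this window the deviation bound is not available, so the bad event is made empty there.
  let near : ℕ × ℕ → Prop := fun q => 0 < q.1 + q.2 ∧
    Real.exp (-c) * (q.1 / (q.1 + q.2 : ℝ)) ≤ p ∧ Real.exp (-c) * (q.2 / (q.1 + q.2 : ℝ)) ≤ 1 - p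
  let bad : ℕ × ℕ → Set Ω := fun q =>
    {ω | near q ∧ ε * (q.1 + q.2 : ℕ) < |χ q.1 q.2 ω - (q.1 + q.2 : ℕ) * I|}
  have hbad : ∀ q, P (bad q) ≤
      ENNReal.ofReal (K * ((q.1 + q.2 + 1) * Real.exp (-c) ^ (q.1 + q.2))) := by
    rintro ⟨a, b⟩
    by_cases hq : near (a, b)
    swap
    · have : bad (a, b) = ∅ := by ext ω; simp [bad, hq]
      rw [this]; simp
    let ℓ₀ := Fin.append (fun _ : Fin a => true) (fun _ : Fin b => false)
    let B : Set (S × (Fin (a + b) → E)) :=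
      {q | ε * (a + b : ℕ) < |labelCrossings (G q.1 (Finset.univ.image q.2)) ℓ₀ q.2 -
        (a + b : ℕ) * I|}
    have hB : MeasurableSet B := by
      have := measurable_labelCrossings
        (H := fun q : S × (Fin (a + b) → E) => G q.1 (Finset.univ.image q.2))
        (z := fun q => q.2) (hG.measurable (a + b)) ℓ₀
      exact measurableSet_lt measurable_const (this.sub_const _).abs
    have hpre : bad (a, b) = (fun ω => (U ω, Fin.append (fun i : Fin a => X i ω)
        (fun j : Fin b => Y j ω))) ⁻¹' B := by
      ext ω
      simp only [bad, B, χ, Set.mem_preimage, Set.mem_ofPred_eq, hq, true_and,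
        crossCount_eq_labelCrossings, image_append_eq_combinedSample a b (fun i => X i ω)
          (fun j => Y j ω)]
      rfl
    have hZm : Measurable fun ω => (U ω, Fin.append (fun i : Fin a => X i ω)
        (fun j : Fin b => Y j ω)) := by
      refine hU.prodMk (measurable_pi_lambda _ fun k => ?_)
      refine Fin.addCases (fun i => ?_) (fun j => ?_) k
      · simp only [Fin.append_left]; exact hX _
      · simp only [Fin.append_right]; exact hY _
    have := Measure.isProbabilityMeasure_map (μ := P) hU.aemeasurable
    rw [hpre, ← Measure.map_apply hZm hB, map_seed_append_eq hX hY hU hXf hYg hXY hind a b,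
      Measure.prod_apply hB]
    -- By Fubini the seed can be frozen; the bound is uniform over the constructions `G u`.
    calc _ ≤ ∫⁻ _, ENNReal.ofReal (K * ((a + b + 1) * Real.exp (-c) ^ (a + b))) ∂(P.map U) := by
          refine lintegral_mono fun u => ?_
          exact hK a b hq.1 hq.2.1 hq.2.2 (G u) (hG.optimal u) fun i j =>
            measurable_prodMk_left (hG.measurable (a + b) i j)
      _ = _ := by simp
  have hfin := ae_finite_setOfPred_mem (μ := P) (s := bad)
    (ne_top_of_le_ne_top (tsum_pair_ne_top hK0 (Real.exp_pos _).le hx1) (ENNReal.tsum_le_tsum hbad))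
  filter_upwards [hfin] with ω hω
  -- As $m+n\to\infty$, the sequence eventually leaves every finite set of pairs, in particular the
  -- finitely many bad ones.
  have hcof : Tendsto (fun k => (m k, n k)) atTop cofinite := by
    intro s hs
    obtain ⟨T, hT⟩ := ((mem_cofinite.1 hs).image fun q : ℕ × ℕ => q.1 + q.2).bddAbove
    rw [mem_map]
    filter_upwards [hmn.eventually_gt_atTop T] with k hk
    by_contra hks
    exact absurd (hT ⟨(m k, n k), hks, rfl⟩) (not_le.2 hk)
  have hgood : ∀ᶠ k in atTop, ω ∉ bad (m k, n k) :=
    hcof.eventually (p := fun q => ω ∉ bad q) (by rw [eventually_cofinite]; simpa using hω)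
  have hnear1 : ∀ᶠ k in atTop, Real.exp (-c) * ((m k : ℝ) / (m k + n k)) < p :=
    (hp.const_mul (Real.exp (-c))).eventually (gt_mem_nhds (by nlinarith))
  have hnear2 : ∀ᶠ k in atTop, Real.exp (-c) * (1 - (m k : ℝ) / (m k + n k)) < 1 - p :=
    ((hp.const_sub 1).const_mul (Real.exp (-c))).eventually (gt_mem_nhds (by nlinarith))
  filter_upwards [hgood, hnear1, hnear2, hmn.eventually_gt_atTop 0] with k g1 g2 g3 g4
  have ht : (0 : ℝ) < m k + n k := by exact_mod_cast g4
  have hn' : (n k : ℝ) / (m k + n k) = 1 - (m k : ℝ) / (m k + n k) := by field_simp; ring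
  have hnr : near (m k, n k) := ⟨g4, g2.le, by simp only [hn']; exact g3.le⟩
  have hle : |χ (m k) (n k) ω - (m k + n k : ℕ) * I| ≤ ε * (m k + n k : ℕ) := by
    by_contra hcon
    exact g1 ⟨hnr, not_le.1 hcon⟩
  push_cast at hle
  have : χ (m k) (n k) ω / ((m k : ℝ) + (n k : ℝ)) - I =
      (χ (m k) (n k) ω - (m k + n k) * I) / (m k + n k) := by field_simp
  rw [this, abs_div, abs_of_pos ht, div_le_iff₀ ht]
  exact hle

/-! ### Power-type costs and the mixture of the two densities. -/

theorem tendsto_zero_of_isTheta_rpow {lam : ℝ → ℝ} {α : ℝ} (hα : 0 < α)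
    (hT : lam =Θ[𝓝[>] 0] fun b => b ^ α) : Tendsto lam (𝓝[>] 0) (𝓝 0) := by
  refine hT.1.trans_tendsto ?_
  have := (Real.continuousAt_rpow_const 0 α (Or.inr hα.le)).tendsto
  rw [Real.zero_rpow hα.ne'] at this
  exact this.mono_left nhdsWithin_le_nhds

/-- Close to zero `lam` is nonzero by the lower bound, and nonnegative because it is monotone with
limit zero; monotonicity carries positivity to all of $(0,\infty)$. -/
theorem pos_of_isTheta_rpow {lam : ℝ → ℝ} {α : ℝ} (hmono : MonotoneOn lam (Set.Ici 0))
    (hα : 0 < α) (hT : lam =Θ[𝓝[>] 0] fun b => b ^ α) {b : ℝ} (hb : 0 < b) : 0 < lam b := by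
  obtain ⟨C, hC⟩ := hT.2.bound
  have hlt : ∀ᶠ x : ℝ in 𝓝[>] 0, x < b := nhdsWithin_le_nhds (gt_mem_nhds hb)
  obtain ⟨a, ⟨haC, hab⟩, ha⟩ := ((hC.and hlt).and self_mem_nhdsWithin).exists
  have ha0 : (0 : ℝ) < a := ha
  have hne : lam a ≠ 0 := fun h => by
    rw [h, norm_zero, mul_zero, Real.norm_of_nonneg (by positivity)] at haC
    exact absurd haC (not_le.2 (by positivity))
  have hnn : 0 ≤ lam a := by
    refine le_of_tendsto (tendsto_zero_of_isTheta_rpow hα hT) ?_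
    filter_upwards [self_mem_nhdsWithin, nhdsWithin_le_nhds (gt_mem_nhds ha0)] with x hx hxa
    exact hmono (Set.mem_Ici.2 (Set.mem_Ioi.1 hx).le) ha0.le hxa.le
  exact (lt_of_le_of_ne hnn hne.symm).trans_le (hmono ha0.le hb.le hab.le)

theorem ae_tendsto_crossCount_densities {d : ℕ} (hd : 0 < d)
    {f g : EuclideanSpace ℝ (Fin d) → ℝ}
    (hf : Measurable f) (hg : Measurable g) (hf0 : ∀ z, 0 ≤ f z) (hg0 : ∀ z, 0 ≤ g z)
    {Ω : Type*} [MeasurableSpace Ω] {P : Measure Ω} [IsProbabilityMeasure P]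
    {S : Type*} [MeasurableSpace S]
    {X Y : ℕ → Ω → EuclideanSpace ℝ (Fin d)} {U : Ω → S}
    (hX : ∀ i, Measurable (X i)) (hY : ∀ j, Measurable (Y j)) (hU : Measurable U)
    (hXf : ∀ i, P.map (X i) = volume.withDensity fun z => ENNReal.ofReal (f z))
    (hYg : ∀ j, P.map (Y j) = volume.withDensity fun z => ENNReal.ofReal (g z))
    (hXY : iIndepFun (Sum.elim X Y) P)
    (hind : IndepFun U (fun ω => (fun i => X i ω, fun j => Y j ω)) P)
    {p : ℝ} (hp0 : 0 < p) (hp1 : p < 1) {m n : ℕ → ℕ}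
    (hmn : Tendsto (fun k => m k + n k) atTop atTop)
    (hp : Tendsto (fun k => (m k : ℝ) / ((m k : ℝ) + (n k : ℝ))) atTop (𝓝 p))
    {lam : ℝ → ℝ} (hmono : MonotoneOn lam (Set.Ici 0)) (hpos : ∀ b, 0 < b → 0 < lam b)
    (hlim : Tendsto lam (𝓝[>] 0) (𝓝 0))
    {G : S → Finset (EuclideanSpace ℝ (Fin d)) → Digraph (EuclideanSpace ℝ (Fin d))}
    (hG : IsOptimalMatchingConstruction lam G) :
    ∀ᵐ ω ∂P, Tendsto
      (fun k => (crossCount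
        (G (U ω) (combinedSample (m k) (n k) (fun i => X i ω) (fun j => Y j ω)))
        (m k) (n k) (fun i => X i ω) (fun j => Y j ω) : ℝ) / ((m k : ℝ) + (n k : ℝ)))
      atTop (𝓝 (∫ z, 2 * p * (1 - p) * f z * g z / (p * f z + (1 - p) * g z))) := by
  have : Nonempty (Fin d) := ⟨⟨0, hd⟩⟩
  have hq0 : 0 < 1 - p := by linarith
  let φ : EuclideanSpace ℝ (Fin d) → ℝ := fun z => p * f z + (1 - p) * g z
  have hφm : Measurable φ := by fun_prop
  have hpf : ∀ z, 0 ≤ p * f z := fun z => mul_nonneg hp0.le (hf0 z)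
  have hqg : ∀ z, 0 ≤ (1 - p) * g z := fun z => mul_nonneg hq0.le (hg0 z)
  have hφ0 : ∀ z, 0 ≤ φ z := fun z => add_nonneg (hpf z) (hqg z)
  -- The posterior probability of the first sample. Where $\varphi=0$, division gives $r=0$, and the
  -- identities below persist because $f=g=0$ there.
  let r : EuclideanSpace ℝ (Fin d) → ℝ := fun z => p * f z / φ z
  have hrm : Measurable r := (hf.const_mul p).div hφm
  have hr0 : ∀ z, 0 ≤ r z := fun z => div_nonneg (hpf z) (hφ0 z)
  have hr1 : ∀ z, r z ≤ 1 := fun z => div_le_one_of_le₀ (le_add_of_nonneg_right (hqg z)) (hφ0 z)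
  have hφr : ∀ z, φ z * r z = p * f z := fun z => by
    rcases eq_or_ne (φ z) 0 with h | h
    · rw [h, zero_mul]
      have : p * f z + (1 - p) * g z = 0 := h
      linarith [hpf z, hqg z]
    · exact mul_div_cancel₀ _ h
  have hφr' : ∀ z, φ z * (1 - r z) = (1 - p) * g z := fun z => by
    rw [mul_sub, mul_one, hφr]; simp only [φ]; ring
  let M : Measure (EuclideanSpace ℝ (Fin d)) := volume.withDensity fun z => ENNReal.ofReal (φ z)
  let base : Bool → Measure (EuclideanSpace ℝ (Fin d)) := fun b =>
    volume.withDensity fun z => ENNReal.ofReal (if b = true then f z else g z)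
  have hXf' : ∀ i, P.map (X i) = base true := fun i => by simp only [base, if_true]; exact hXf i
  have hYg' : ∀ j, P.map (Y j) = base false := fun j => by
    simp only [base, Bool.false_eq_true, if_false]; exact hYg j
  have hprob : ∀ b, IsProbabilityMeasure (base b) := fun b => by
    cases b
    · rw [← hYg' 0]; exact Measure.isProbabilityMeasure_map (hY 0).aemeasurable
    · rw [← hXf' 0]; exact Measure.isProbabilityMeasure_map (hX 0).aemeasurable
  have hbase : ∀ b, (if b = true then ENNReal.ofReal p else ENNReal.ofReal (1 - p)) • base b =
      M.withDensity fun x => labelLaw (r x) {b} := fun b => by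
    cases b
    · simp only [base, M, labelLaw_singleton, Bool.false_eq_true, if_false]
      rw [← withDensity_smul _ hg.ennreal_ofReal,
        ← withDensity_mul _ hφm.ennreal_ofReal
          (g := fun z => ENNReal.ofReal (1 - r z)) (hrm.const_sub 1).ennreal_ofReal]
      congr 1
      ext z
      simp only [Pi.smul_apply, Pi.mul_apply, smul_eq_mul]
      rw [← ENNReal.ofReal_mul hq0.le, ← ENNReal.ofReal_mul (hφ0 z), hφr']
    · simp only [base, M, labelLaw_singleton, if_true]
      rw [← withDensity_smul _ hf.ennreal_ofReal,
        ← withDensity_mul _ hφm.ennreal_ofReal hrm.ennreal_ofReal]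
      congr 1
      ext z
      simp only [Pi.smul_apply, Pi.mul_apply, smul_eq_mul]
      rw [← ENNReal.ofReal_mul hp0.le, ← ENNReal.ofReal_mul (hφ0 z), hφr]
  have hM : IsProbabilityMeasure M := by
    have hsum : M = ENNReal.ofReal p • base true + ENNReal.ofReal (1 - p) • base false := by
      simp only [base, M, Bool.false_eq_true, if_false, if_true]
      rw [← withDensity_smul _ hg.ennreal_ofReal, ← withDensity_smul _ hf.ennreal_ofReal,
        ← withDensity_add_left (hf.ennreal_ofReal.const_smul _)]
      congr 1
      ext z
      simp only [Pi.smul_apply, Pi.add_apply, smul_eq_mul, φ]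
      rw [← ENNReal.ofReal_mul hp0.le, ← ENNReal.ofReal_mul hq0.le,
        ← ENNReal.ofReal_add (hpf z) (hqg z)]
    constructor
    rw [hsum, Measure.add_apply, Measure.smul_apply, Measure.smul_apply, measure_univ, measure_univ,
      smul_eq_mul, smul_eq_mul, mul_one, mul_one, ← ENNReal.ofReal_add hp0.le hq0.le]
    simp
  have hlimit : ∫ x, 2 * r x * (1 - r x) ∂M =
      ∫ z, 2 * p * (1 - p) * f z * g z / (p * f z + (1 - p) * g z) := by
    rw [integral_withDensity_eq_integral_toReal_smul hφm.ennreal_ofReal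
      (ae_of_all _ fun _ => ENNReal.ofReal_lt_top)]
    refine integral_congr_ae (ae_of_all _ fun z => ?_)
    simp only [smul_eq_mul]
    rw [ENNReal.toReal_ofReal (hφ0 z),
      show φ z * (2 * r z * (1 - r z)) = 2 * r z * (φ z * (1 - r z)) by ring, hφr']
    simp only [r, φ]
    ring
  rw [← hlimit]
  exact ae_tendsto_crossCount hp0 hp1 hrm hr0 hr1 hbase hmono hpos hlim hX hY hU hXf' hYg' hXY hind
    hmn hp hG

theorem corollary1 {d : ℕ}
    -- the two densities
    (f g : EuclideanSpace ℝ (Fin d) → ℝ)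
    (hf : Measurable f) (hg : Measurable g) (hf0 : ∀ z, 0 ≤ f z) (hg0 : ∀ z, 0 ≤ g z)
    -- the two independent samples, and an independent seed for the choice among optimal matchings
    {Ω : Type*} [MeasurableSpace Ω] (P : Measure Ω) [IsProbabilityMeasure P]
    {S : Type*} [MeasurableSpace S]
    (X Y : ℕ → Ω → EuclideanSpace ℝ (Fin d)) (U : Ω → S)
    (hX : ∀ i, Measurable (X i)) (hY : ∀ j, Measurable (Y j)) (hU : Measurable U)
    (hXf : ∀ i, P.map (X i) = volume.withDensity fun z => ENNReal.ofReal (f z))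
    (hYg : ∀ j, P.map (Y j) = volume.withDensity fun z => ENNReal.ofReal (g z))
    (hXY : iIndepFun (Sum.elim X Y) P)
    (hind : IndepFun U (fun ω => (fun i => X i ω, fun j => Y j ω)) P)
    -- the limiting regime
    (p : ℝ) (hp0 : 0 < p) (hp1 : p < 1) (m n : ℕ → ℕ)
    (hmn : Tendsto (fun k => m k + n k) atTop atTop)
    (hp : Tendsto (fun k => (m k : ℝ) / ((m k : ℝ) + (n k : ℝ))) atTop (𝓝 p)) :
    -- general optimal matchings
    (∀ (lam : ℝ → ℝ) (α : ℝ), MonotoneOn lam (Set.Ici 0) → 0 < α → α < d →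
      lam =Θ[𝓝[>] 0] (fun b => b ^ α) →
      ∀ G : S → Finset (EuclideanSpace ℝ (Fin d)) → Digraph (EuclideanSpace ℝ (Fin d)),
        IsOptimalMatchingConstruction lam G →
        ∀ᵐ ω ∂P, Tendsto
          (fun k => (crossCount
            (G (U ω) (combinedSample (m k) (n k) (fun i => X i ω) (fun j => Y j ω)))
            (m k) (n k) (fun i => X i ω) (fun j => Y j ω) : ℝ) / ((m k : ℝ) + (n k : ℝ)))
          atTop (𝓝 (∫ z, 2 * p * (1 - p) * f z * g z / (p * f z + (1 - p) * g z)))) ∧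
    -- the matching of minimal total Euclidean distance
    (2 ≤ d →
      ∀ G : S → Finset (EuclideanSpace ℝ (Fin d)) → Digraph (EuclideanSpace ℝ (Fin d)),
        IsOptimalMatchingConstruction (fun b => b) G →
        ∀ᵐ ω ∂P, Tendsto
          (fun k => (crossCount
            (G (U ω) (combinedSample (m k) (n k) (fun i => X i ω) (fun j => Y j ω)))
            (m k) (n k) (fun i => X i ω) (fun j => Y j ω) : ℝ) / ((m k : ℝ) + (n k : ℝ)))
          atTop (𝓝 (∫ z, 2 * p * (1 - p) * f z * g z / (p * f z + (1 - p) * g z)))) := by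
  refine ⟨fun lam α hmono hα hαd hT G hG => ?_, fun hd G hG => ?_⟩
  -- $0<\alpha<d$ forces $d>0$, so points are Lebesgue null.
  · exact ae_tendsto_crossCount_densities (by exact_mod_cast hα.trans hαd) hf hg hf0 hg0 hX hY hU hXf
      hYg hXY hind hp0 hp1 hmn hp hmono (fun b hb => pos_of_isTheta_rpow hmono hα hT hb)
      (tendsto_zero_of_isTheta_rpow hα hT) hG
  · exact ae_tendsto_crossCount_densities (by omega) hf hg hf0 hg0 hX hY hU hXf
      hYg hXY hind hp0 hp1 hmn hp (fun _ _ _ _ h => h) (fun b hb => hb)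
      (tendsto_id.mono_left nhdsWithin_le_nhds) hG
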